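/- Let $n\ge 1$, $m\ge 2$, $q>0$ and $\kappa\ge 0$. Then there exists $\varepsilon>0$, depending only on $n$, $m$, $q$ and $\kappa$, with the following property. Let $M\subset\mathbb R^m$ be a domain of class $C^3$ whose complement is a closed convex set with nonempty interior, and suppose that all principal curvatures of $\partial M$ are bounded by $\kappa$ in absolute value. Let $\rho$ be the signed distance function to $\partial M$, positive in $M$. Let $\Omega\subset\mathbb R^n$ be a bounded domain, and put $W^{1,2}(\Omega;\overline M)=\{v\in W^{1,2}(\Omega;\mathbb R^m): v\in\overline M \text{ a.e. in }\Omega\}$. Let $u\in W^{1,2}(\Omega;\overline M)$ be a minimizing constraint map, that is, $$\int_\Omega\big(|Du|^2+q^2\chi_{u^{-1}(M)}\big)\,dx\le\int_\Omega\big(|Dv|^2+q^2\chi_{v^{-1}(M)}\big)\,dx$$ for all $v\in W^{1,2}(\Omega;\overline M)\cap\big(u+W^{1,2}_0(\Omega;\mathbb R^m)\big)$. Then, whenever $B_{2r}(x_0)\subset\Omega$ and $r\in(0,1)$, $$\sup_{B_{2r}(x_0)}(\rho\circ u)\le\varepsilon r\quad\Longrightarrow\quad B_r(x_0)\subset u^{-1}(\partial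 M).$$ Here the supremum is the essential supremum, and the inclusion means that $u(x)\in\partial M$ for almost every $x\in B_r(x_0)$, and for every $x\in B_r(x_0)$ if $u$ is represented so that $\rho\circ u$ is continuous in $B_r(x_0)$. -/

import Mathlib

open MeasureTheory Filter Topology
open scoped ContDiff

namespace ConstraintMap

/-- `ℝᵏ` with its Euclidean norm. -/
abbrev Euc (k : ℕ) : Type := EuclideanSpace ℝ (Fin k)

/-! ### The target domain -/

/-- A domain of class `C³`: a nonempty connected open set which near each of its boundary points
is the positivity set of a `C³` function without critical points. -/
structure IsC3Domain {m : ℕ} (M : Set (Euc m)) : Prop where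
  isOpen : IsOpen M
  isConnected : IsConnected M
  exists_defining : ∀ a ∈ frontier M, ∃ (U : Set (Euc m)) (φ : Euc m → ℝ),
    IsOpen U ∧ a ∈ U ∧ ContDiffOn ℝ 3 φ U ∧ (∀ y ∈ U, fderiv ℝ φ y ≠ 0) ∧
      M ∩ U = {y ∈ U | 0 < φ y}

open Classical in
/-- The signed distance `ρ` to `∂M`, positive in `M`. -/
noncomputable def rho {m : ℕ} (M : Set (Euc m)) (y : Euc m) : ℝ :=
  if y ∈ M then Metric.infDist y (frontier M) else -Metric.infDist y (frontier M)

/-- `k` is a principal curvature of `∂M` at `a ∈ ∂M`: an eigenvalue of the second fundamental form,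
i.e. of the restriction of `Hess ρ` at `a` to the tangent space `{ξ | ∇ρ(a) · ξ = 0}` of `∂M`.
(For a `C³` domain, `ρ` is `C³` near `∂M`. With this sign, the principal curvatures are nonnegative
when the complement of `M` is convex.) -/
def IsPrincipalCurvature {m : ℕ} (M : Set (Euc m)) (a : Euc m) (k : ℝ) : Prop :=
  ∃ ξ : Euc m, ξ ≠ 0 ∧ fderiv ℝ (rho M) a ξ = 0 ∧
    ∀ η : Euc m, fderiv ℝ (rho M) a η = 0 →
      fderiv ℝ (fderiv ℝ (rho M)) a ξ η = k * inner ℝ ξ η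

/-- All principal curvatures of `∂M` are bounded by `κ` in absolute value. -/
def CurvatureBounded {m : ℕ} (M : Set (Euc m)) (κ : ℝ) : Prop :=
  ∀ a ∈ frontier M, ∀ k : ℝ, IsPrincipalCurvature M a k → |k| ≤ κ

/-! ### Sobolev maps -/

/-- `u ∈ W^{1,2}(Ω; ℝᵐ)` with weak differential `Du`. -/
structure IsW12 {n m : ℕ} (Ω : Set (Euc n)) (u : Euc n → Euc m)
    (Du : Euc n → Euc n →L[ℝ] Euc m) : Prop where
  memLp : MemLp u 2 (volume.restrict Ω)
  memLp_deriv : MemLp Du 2 (volume.restrict Ω)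
  weak_deriv : ∀ φ : Euc n → ℝ, ContDiff ℝ ∞ φ → HasCompactSupport φ → tsupport φ ⊆ Ω →
    ∀ e : Euc n, ∫ x in Ω, (fderiv ℝ φ x e) • u x = -∫ x in Ω, φ x • Du x e

/-- `w`, with differential `Dw`, belongs to `W^{1,2}_0(Ω; ℝᵐ)`, the closure of `C_c^∞(Ω; ℝᵐ)` in the
`W^{1,2}` norm. -/
def IsW12Zero {n m : ℕ} (Ω : Set (Euc n)) (w : Euc n → Euc m)
    (Dw : Euc n → Euc n →L[ℝ] Euc m) : Prop :=
  ∃ Φ : ℕ → Euc n → Euc m,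
    (∀ j, ContDiff ℝ ∞ (Φ j) ∧ HasCompactSupport (Φ j) ∧ tsupport (Φ j) ⊆ Ω) ∧
    Tendsto (fun j => eLpNorm (fun x => w x - Φ j x) 2 (volume.restrict Ω)) atTop (𝓝 0) ∧
    Tendsto (fun j => eLpNorm (fun x => Dw x - fderiv ℝ (Φ j) x) 2 (volume.restrict Ω)) atTop (𝓝 0)

/-! ### The energy and its minimizers -/

/-- The squared Frobenius norm `|L|² = ∑_α |L e_α|²`. -/
noncomputable def frobSq {n m : ℕ} (L : Euc n →L[ℝ] Euc m) : ℝ :=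
  ∑ α : Fin n, ‖L (EuclideanSpace.single α 1)‖ ^ 2

/-- The energy `∫_Ω (|Dv|² + q² χ_{v⁻¹(M)}) dx`. For `v` in `W^{1,2}` and `Ω` bounded the integrand is
integrable. -/
noncomputable def energy {n m : ℕ} (q : ℝ) (M : Set (Euc m)) (Ω : Set (Euc n)) (v : Euc n → Euc m)
    (Dv : Euc n → Euc n →L[ℝ] Euc m) : ℝ :=
  ∫ x in Ω, (frobSq (Dv x) + q ^ 2 * (v ⁻¹' M).indicator (fun _ => (1 : ℝ)) x)

/-- `u ∈ W^{1,2}(Ω; M̄)` with weak differential `Du`. -/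
def IsConstraintMap {n m : ℕ} (M : Set (Euc m)) (Ω : Set (Euc n)) (u : Euc n → Euc m)
    (Du : Euc n → Euc n →L[ℝ] Euc m) : Prop :=
  IsW12 Ω u Du ∧ ∀ᵐ x ∂volume.restrict Ω, u x ∈ closure M

/-- `u` is a minimizing constraint map: `u ∈ W^{1,2}(Ω; M̄)`, and its energy is at most that of every
`v ∈ W^{1,2}(Ω; M̄) ∩ (u + W^{1,2}_0(Ω; ℝᵐ))`. -/
def IsMinimizing {n m : ℕ} (q : ℝ) (M : Set (Euc m)) (Ω : Set (Euc n)) (u : Euc n → Euc m) : Prop :=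
  ∃ Du : Euc n → Euc n →L[ℝ] Euc m, IsConstraintMap M Ω u Du ∧
    ∀ (v : Euc n → Euc m) (Dv : Euc n → Euc n →L[ℝ] Euc m), IsConstraintMap M Ω v Dv →
      IsW12Zero Ω (fun x => v x - u x) (fun x => Dv x - Du x) →
      energy q M Ω u Du ≤ energy q M Ω v Dv

end ConstraintMap

/-! Let `C = Mᶜ`, let `h` be the distance from `u` to `C`, and let `P` be the nearest point
projection onto `C`. The competitor `V` pushes `u` towards `P u` by the depth `t = max (min h δ - φ)
0`, where `δ = ε r` and `φ = max (ε β) 0`. The barrier `β` is nonpositive in `B_r`, at least `r`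
outside `B_{3r/2}`, and superharmonic outside `B_r`. Hence `V = u` outside `B_{3r/2}`, while a.e. in
`B_r`, where `φ = 0` and `h ≤ δ`, one has `V = P u ∈ C`: there the `q²` term is saved wherever `u ∈
M`.

Convexity of `C` bounds the Dirichlet energy: `|DV|² ≤ |Du|² - 2 Dh·Dt + |Dt|²`
(`norm_sub_sq_retraction_le`). Where `t > 0` one has `h = t + φ`, so the right side is `|Du|² -
|Dt|² - 2 Dφ·Dt`. The sign of the last term is settled by `∫ (Dβ·Dt + t Δβ) = 0`. Outside `B_r`,
superharmonicity gives the right sign. Inside, where `φ = 0`, the quantity `2ε (Dβ·Dt + t Δβ)` is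
absorbed by `|Dt|²` up to an error `(2K + K²) ε²`. This error is smaller than `q²`, so minimality
forces `{u ∈ M} ∩ B_r` to be null (`ae_notMem_of_isMinimizing`).

The depth and the displacement are only Lipschitz in `(x, u)`, so no chain rule is used. Their weak
derivatives exist because difference quotients stay bounded in `L²`
(`exists_hasWeakDirDeriv_of_lipschitz`). Inequalities between increments pass to weak derivatives
along a.e. convergent difference quotients (`ae_retraction_inequality`), and the identities between
derivatives come from one function touching another from below (`ae_eq_of_touching_below`). -/

namespace ConstraintMap

/-! ### Mollification in `L²`. -/

section Averages

open Convolution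

variable {n : ℕ} {F : Type*} [NormedAddCommGroup F]

theorem eLpNorm_two_sq {α : Type*} [MeasurableSpace α] (μ : Measure α) (f : α → F) :
    eLpNorm f 2 μ ^ 2 = ∫⁻ x, ‖f x‖ₑ ^ 2 ∂μ := by
  have h := eLpNorm_nnreal_pow_eq_lintegral (μ := μ) (f := f) (p := 2) (by norm_num)
  have h2 : ((2 : NNReal) : ℝ) = ((2 : ℕ) : ℝ) := by norm_num
  simpa [h2] using h

/-- Averages of translates do not increase the `L²` norm. -/
theorem lintegral_average_translate_sq_le {S : Type*} [MeasurableSpace S] (ν : Measure S)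
    [IsFiniteMeasure ν] (c : S → Euc n) (hc : Measurable c) (g : Euc n → ENNReal)
    (hg : Measurable g) :
    ∫⁻ x, (∫⁻ s, g (x + c s) ∂ν) ^ 2 ≤ ν Set.univ ^ 2 * ∫⁻ x, g x ^ 2 := by
  have hgm : Measurable fun p : Euc n × S => g (p.1 + c p.2) := by fun_prop
  have key : ∀ x, (∫⁻ s, g (x + c s) ∂ν) ^ 2 ≤ ν Set.univ * ∫⁻ s, g (x + c s) ^ 2 ∂ν := by
    intro x
    have hm : Measurable fun s => g (x + c s) := by fun_prop
    -- Hölder with both exponents `1 / 2`, applied to `1` and `g²`, is the Cauchy–Schwarz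
    -- inequality.
    have h := ENNReal.lintegral_mul_norm_pow_le (μ := ν) (f := fun _ => 1)
      (g := fun s => g (x + c s) ^ 2) aemeasurable_const (hm.pow_const 2).aemeasurable
      (p := 1 / 2) (q := 1 / 2) (by norm_num) (by norm_num) (by norm_num)
    have e : ∀ y : ENNReal, (y ^ 2) ^ (1 / 2 : ℝ) = y := fun y => by
      rw [← ENNReal.rpow_natCast, ← ENNReal.rpow_mul]; norm_num
    have e' : ∀ y : ENNReal, (y ^ (1 / 2 : ℝ)) ^ 2 = y := fun y => by
      rw [← ENNReal.rpow_natCast, ← ENNReal.rpow_mul]; norm_num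
    simp only [e, ENNReal.one_rpow, one_mul, lintegral_one] at h
    calc _ ≤ _ := pow_le_pow_left₀ bot_le h 2
      _ = _ := by rw [mul_pow, e', e']
  calc ∫⁻ x, (∫⁻ s, g (x + c s) ∂ν) ^ 2
      ≤ ∫⁻ x, ν Set.univ * ∫⁻ s, g (x + c s) ^ 2 ∂ν := lintegral_mono key
    _ = ν Set.univ * ∫⁻ x, ∫⁻ s, g (x + c s) ^ 2 ∂ν :=
        lintegral_const_mul _ (hgm.pow_const 2).lintegral_prod_right'
    _ = ν Set.univ * ∫⁻ s, (∫⁻ x, g (x + c s) ^ 2) ∂ν := by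
        rw [lintegral_lintegral_swap (hgm.pow_const 2).aemeasurable]
    _ = ν Set.univ * ∫⁻ _, (∫⁻ x, g x ^ 2) ∂ν := by
        congr 1
        refine lintegral_congr fun s => ?_
        exact lintegral_add_right_eq_self (fun x => g x ^ 2) (c s)
    _ = _ := by rw [lintegral_const]; ring

theorem tendsto_eLpNorm_zero_of_dominated {ι : Type*} {l : Filter ι} [l.IsCountablyGenerated]
    {G : ι → Euc n → F} (hG : ∀ᶠ i in l, StronglyMeasurable (G i)) {K : Set (Euc n)}
    (hK : IsCompact K) (C : ℝ) (hsupp : ∀ᶠ i in l, ∀ x ∉ K, G i x = 0)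
    (hbd : ∀ᶠ i in l, ∀ x, ‖G i x‖ ≤ C) (hlim : ∀ x, Tendsto (fun i => G i x) l (𝓝 0)) :
    Tendsto (fun i => eLpNorm (G i) 2 volume) l (𝓝 0) := by
  have h : Tendsto (fun i => ∫⁻ x, ‖G i x‖ₑ ^ 2) l (𝓝 (∫⁻ _ : Euc n, 0)) := by
    refine tendsto_lintegral_filter_of_dominated_convergence
      (K.indicator fun _ => ENNReal.ofReal C ^ 2) ?_ ?_ ?_ ?_
    · filter_upwards [hG] with i hi using hi.enorm.pow_const 2
    · filter_upwards [hsupp, hbd] with i h1 h2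
      refine Eventually.of_forall fun x => ?_
      by_cases hx : x ∈ K
      · rw [Set.indicator_of_mem hx, ← ofReal_norm]
        gcongr
        exact h2 x
      · rw [Set.indicator_of_notMem hx, h1 x hx]; simp
    · rw [lintegral_indicator hK.measurableSet, setLIntegral_const]
      exact ENNReal.mul_ne_top (by finiteness) hK.measure_lt_top.ne
    · refine Eventually.of_forall fun x => ?_
      have h1 : Tendsto (fun i => ‖G i x‖ₑ) l (𝓝 0) := by
        simpa using (hlim x).enorm
      simpa using ENNReal.Tendsto.pow (n := 2) h1
  rw [lintegral_zero] at h
  have h2 : ∀ i, eLpNorm (G i) 2 volume = (∫⁻ x, ‖G i x‖ₑ ^ 2) ^ (1 / 2 : ℝ) := fun i => by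
    rw [← eLpNorm_two_sq, ← ENNReal.rpow_natCast, ← ENNReal.rpow_mul]; norm_num
  simp_rw [h2]
  have h3 := h.ennrpow_const (1 / 2 : ℝ)
  simpa using h3

variable [NormedSpace ℝ F]

/-- The kernel has mass one, so the convolution is an average of translates of `f` with respect to a
probability measure. -/
theorem eLpNorm_normed_convolution_le (φ : ContDiffBump (0 : Euc n)) (f : Euc n → F)
    (hf : AEStronglyMeasurable f volume) :
    eLpNorm (φ.normed volume ⋆[ContinuousLinearMap.lsmul ℝ ℝ, volume] f) 2 volume ≤
      eLpNorm f 2 volume := by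
  rw [convolution_congr (g' := hf.mk f) _ (EventuallyEq.refl _ _) hf.ae_eq_mk,
    eLpNorm_congr_ae hf.ae_eq_mk]
  set g := hf.mk f
  have hg : StronglyMeasurable g := hf.stronglyMeasurable_mk
  rw [← ENNReal.pow_le_pow_left_iff two_ne_zero, eLpNorm_two_sq, eLpNorm_two_sq]
  set w : Euc n → ENNReal := fun t => ENNReal.ofReal (φ.normed volume t)
  have hw : Measurable w := φ.continuous_normed.measurable.ennreal_ofReal
  have hν : (volume.withDensity w) Set.univ = 1 := by
    rw [withDensity_apply _ MeasurableSet.univ, setLIntegral_univ,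
      ← ofReal_integral_eq_lintegral_ofReal φ.integrable_normed
        (Eventually.of_forall φ.nonneg_normed), φ.integral_normed, ENNReal.ofReal_one]
  have : IsFiniteMeasure (volume.withDensity w) := ⟨by simp [hν]⟩
  have h := lintegral_average_translate_sq_le (volume.withDensity w) (fun s => -s)
    measurable_neg (fun x => ‖g x‖ₑ) hg.enorm
  rw [hν, one_pow, one_mul] at h
  refine le_trans (lintegral_mono fun x => ?_) h
  gcongr
  have hm : Measurable fun s => ‖g (x + -s)‖ₑ := hg.enorm.comp (by fun_prop)
  rw [lintegral_withDensity_eq_lintegral_mul _ hw hm]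
  refine (enorm_integral_le_lintegral_enorm _).trans (lintegral_mono fun t => ?_)
  simp only [ContinuousLinearMap.lsmul_apply, enorm_smul, Pi.mul_apply, w, ← sub_eq_add_neg]
  rw [Real.enorm_of_nonneg (φ.nonneg_normed t)]

/-- For continuous compactly supported maps this is dominated convergence. The general case follows
by density, since mollification is an `L²` contraction. -/
theorem tendsto_eLpNorm_normed_convolution_sub [CompleteSpace F] (φ : ℕ → ContDiffBump (0 : Euc n))
    (hφ : Tendsto (fun k => (φ k).rOut) atTop (𝓝 0)) (f : Euc n → F) (hf : MemLp f 2 volume) :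
    Tendsto (fun k => eLpNorm
      (fun x => ((φ k).normed volume ⋆[ContinuousLinearMap.lsmul ℝ ℝ, volume] f) x - f x) 2 volume)
      atTop (𝓝 0) := by
  have hcpt : ∀ g : Euc n → F, HasCompactSupport g → Continuous g → Tendsto (fun k => eLpNorm
      (fun x => ((φ k).normed volume ⋆[ContinuousLinearMap.lsmul ℝ ℝ, volume] g) x - g x) 2 volume)
      atTop (𝓝 0) := by
    intro g hg hgc
    obtain ⟨C, hC⟩ := hg.exists_bound_of_continuous hgc
    have hsmall : ∀ᶠ k in atTop, (φ k).rOut < 1 := hφ.eventually_lt_const one_pos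
    refine tendsto_eLpNorm_zero_of_dominated (K := Metric.cthickening 1 (tsupport g))
      (Eventually.of_forall fun k => ?_) hg.isCompact.cthickening (2 * C) ?_ ?_ ?_
    · exact (((φ k).hasCompactSupport_normed.continuous_convolution_left _
        (φ k).continuous_normed hgc.locallyIntegrable).sub hgc).stronglyMeasurable
    · filter_upwards [hsmall] with k hk x hx
      have hz : ∀ y ∈ Metric.ball x (φ k).rOut, g y = 0 := by
        intro y hy
        by_contra hne
        refine hx (Metric.mem_cthickening_of_dist_le x y 1 _ (subset_tsupport g hne) ?_)
        rw [dist_comm]; exact (lt_trans hy hk).le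
      have hx0 : g x = 0 := hz x (Metric.mem_ball_self (φ k).rOut_pos)
      rw [ContDiffBump.normed_convolution_eq_right (fun y hy => by rw [hz y hy, hx0]), sub_self]
    · refine Eventually.of_forall fun k x => ?_
      rw [← dist_eq_norm]
      refine ContDiffBump.dist_normed_convolution_le hgc.aestronglyMeasurable fun y _ => ?_
      rw [dist_eq_norm]
      exact (norm_sub_le _ _).trans (by linarith [hC x, hC y])
    · intro x
      have := (ContDiffBump.convolution_tendsto_right_of_continuous (μ := volume) hφ hgc x).sub_const
        (g x)
      simpa using this
  rw [ENNReal.tendsto_nhds_zero]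
  intro ε hε
  obtain ⟨g, hgs, hgε, hgc, hgm⟩ := hf.exists_hasCompactSupport_eLpNorm_sub_le (p := 2)
    (by norm_num) (ε := ε / 3) (by simpa using hε.ne')
  filter_upwards [(ENNReal.tendsto_nhds_zero.1 (hcpt g hgs hgc)) (ε / 3)
    (ENNReal.div_pos hε.ne' (by norm_num))] with k hk
  set T : (Euc n → F) → Euc n → F := fun f =>
    (φ k).normed volume ⋆[ContinuousLinearMap.lsmul ℝ ℝ, volume] f with hT
  have hex : ∀ f : Euc n → F, MemLp f 2 volume → ConvolutionExists ((φ k).normed volume) f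
      (ContinuousLinearMap.lsmul ℝ ℝ) volume := fun f hf =>
    (φ k).hasCompactSupport_normed.convolutionExists_left _ (φ k).continuous_normed
      (hf.locallyIntegrable (by norm_num))
  have hcont : ∀ f : Euc n → F, MemLp f 2 volume → Continuous (T f) := fun f hf =>
    (φ k).hasCompactSupport_normed.continuous_convolution_left _ (φ k).continuous_normed
      (hf.locallyIntegrable (by norm_num))
  have hlin : T (f - g) = T f - T g := by
    have h1 : f = (f - g) + g := by simp
    have h2 : T f = T (f - g) + T g := by
      conv_lhs => rw [h1]
      exact (hex _ (hf.sub hgm)).distrib_add (hex _ hgm)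
    rw [h2]; simp
  have hsplit : (fun x => T f x - f x) = T (f - g) + ((fun x => T g x - g x) + -(f - g)) := by
    rw [hlin]; ext x; simp
  have m1 : AEStronglyMeasurable (T (f - g)) volume :=
    (hcont _ (hf.sub hgm)).aestronglyMeasurable
  have m2 : AEStronglyMeasurable (fun x => T g x - g x) volume :=
    ((hcont _ hgm).sub hgc).aestronglyMeasurable
  have m3 : AEStronglyMeasurable (-(f - g)) volume := (hf.sub hgm).1.neg
  change eLpNorm (fun x => T f x - f x) 2 volume ≤ ε
  rw [hsplit]
  calc _ ≤ eLpNorm (T (f - g)) 2 volume + eLpNorm ((fun x => T g x - g x) + -(f - g)) 2 volume :=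
        eLpNorm_add_le m1 (m2.add m3) (by norm_num)
    _ ≤ ε / 3 + (ε / 3 + ε / 3) := by
        gcongr
        · exact (eLpNorm_normed_convolution_le _ _ (hf.sub hgm).1).trans hgε
        · refine (eLpNorm_add_le m2 m3 (by norm_num)).trans ?_
          rw [eLpNorm_neg]
          gcongr
    _ = ε := by rw [← add_assoc, ENNReal.add_thirds]

end Averages

/-! ### Weak directional derivatives and difference quotients. -/

section WeakDerivative

open Convolution

variable {n : ℕ} {F : Type*} [NormedAddCommGroup F]

theorem eLpNorm_comp_add_right {f : Euc n → F} (hf : AEStronglyMeasurable f volume) (a : Euc n) :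
    eLpNorm (fun x => f (x + a)) 2 volume = eLpNorm f 2 volume :=
  eLpNorm_comp_measurePreserving hf (measurePreserving_add_right volume a)

theorem aestronglyMeasurable_comp_add_right {f : Euc n → F} (hf : AEStronglyMeasurable f volume)
    (a : Euc n) : AEStronglyMeasurable (fun x => f (x + a)) volume :=
  hf.comp_measurePreserving (measurePreserving_add_right volume a)

theorem _root_.MeasureTheory.MemLp.comp_add_right {f : Euc n → F} (hf : MemLp f 2 volume)
    (a : Euc n) : MemLp (fun x => f (x + a)) 2 volume :=
  hf.comp_measurePreserving (measurePreserving_add_right volume a)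

variable [NormedSpace ℝ F]

/-- `f ∈ L²` has the weak derivative `f' ∈ L²` in the direction `e`. -/
structure HasWeakDirDeriv (e : Euc n) (f f' : Euc n → F) : Prop where
  memLp : MemLp f 2 volume
  memLp_deriv : MemLp f' 2 volume
  weak_deriv : ∀ ζ : Euc n → ℝ, ContDiff ℝ ∞ ζ → HasCompactSupport ζ →
    ∫ x, fderiv ℝ ζ x e • f x = -∫ x, ζ x • f' x

/-- The difference quotient of `f` in the direction `e` with step `t`. -/
noncomputable def diffQuot (e : Euc n) (t : ℝ) (f : Euc n → F) (x : Euc n) : F :=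
  t⁻¹ • (f (x + t • e) - f x)

theorem _root_.MeasureTheory.MemLp.diffQuot {f : Euc n → F} (hf : MemLp f 2 volume) (e : Euc n)
    (t : ℝ) : MemLp (diffQuot e t f) 2 volume :=
  ((hf.comp_add_right (t • e)).sub hf).const_smul t⁻¹

theorem diffQuot_sub (e : Euc n) (t : ℝ) (f g : Euc n → F) :
    diffQuot e t (f - g) = diffQuot e t f - diffQuot e t g := by
  ext x
  simp only [diffQuot, Pi.sub_apply, ← smul_sub]
  congr 1
  abel

/-- The increment is `t` times the average over `s ∈ [0, 1]` of the derivative at `x + s t e`, and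
averages of translates do not increase the `L²` norm. -/
theorem eLpNorm_translate_sub_le_of_contDiff [CompleteSpace F] {Φ : Euc n → F}
    (hΦ : ContDiff ℝ 1 Φ) (e : Euc n) (t : ℝ) :
    eLpNorm (fun x => Φ (x + t • e) - Φ x) 2 volume ≤
      ‖t‖ₑ * eLpNorm (fun x => fderiv ℝ Φ x e) 2 volume := by
  have hcont : Continuous fun x => fderiv ℝ Φ x e :=
    (hΦ.continuous_fderiv (by norm_num)).clm_apply continuous_const
  have hpt : ∀ x, ‖Φ (x + t • e) - Φ x‖ₑ ≤
      ‖t‖ₑ * ∫⁻ s in Set.Ioc (0 : ℝ) 1, ‖fderiv ℝ Φ (x + (s * t) • e) e‖ₑ := by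
    intro x
    have hder : ∀ s : ℝ, HasDerivAt (fun s : ℝ => Φ (x + (s * t) • e))
        (t • fderiv ℝ Φ (x + (s * t) • e) e) s := by
      intro s
      have h1 : HasDerivAt (fun s : ℝ => x + (s * t) • e) (t • e) s := by
        have := (((hasDerivAt_id s).mul_const t).smul_const e).const_add x
        simpa using this
      have h2 := ((hΦ.differentiable (by norm_num)) (x + (s * t) • e)).hasFDerivAt.comp_hasDerivAt
        s h1
      simpa [Function.comp_def] using h2
    have hc : Continuous fun s : ℝ => t • fderiv ℝ Φ (x + (s * t) • e) e := by
      have : Continuous fun s : ℝ => x + (s * t) • e := by fun_prop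
      exact (hcont.comp this).const_smul t
    have h := intervalIntegral.integral_eq_sub_of_hasDerivAt (fun s _ => hder s)
      (hc.intervalIntegrable 0 1)
    simp only [one_mul, zero_mul, zero_smul, add_zero] at h
    rw [← h, intervalIntegral.integral_of_le zero_le_one]
    refine (enorm_integral_le_lintegral_enorm _).trans ?_
    simp only [enorm_smul]
    rw [lintegral_const_mul]
    exact (hcont.comp (by fun_prop)).enorm.measurable
  rw [← ENNReal.pow_le_pow_left_iff two_ne_zero, mul_pow, eLpNorm_two_sq, eLpNorm_two_sq]
  have h := lintegral_average_translate_sq_le (volume.restrict (Set.Ioc (0 : ℝ) 1))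
    (fun s => (s * t) • e) (by fun_prop) (fun x => ‖fderiv ℝ Φ x e‖ₑ) hcont.enorm.measurable
  rw [Measure.restrict_apply MeasurableSet.univ, Set.univ_inter, Real.volume_Ioc, sub_zero,
    ENNReal.ofReal_one, one_pow, one_mul] at h
  calc ∫⁻ x, ‖Φ (x + t • e) - Φ x‖ₑ ^ 2
      ≤ ∫⁻ x, ‖t‖ₑ ^ 2 * (∫⁻ s in Set.Ioc (0 : ℝ) 1, ‖fderiv ℝ Φ (x + (s * t) • e) e‖ₑ) ^ 2 := by
        refine lintegral_mono fun x => ?_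
        rw [← mul_pow]
        gcongr
        exact hpt x
    _ = ‖t‖ₑ ^ 2 * ∫⁻ x, (∫⁻ s in Set.Ioc (0 : ℝ) 1, ‖fderiv ℝ Φ (x + (s * t) • e) e‖ₑ) ^ 2 := by
        rw [lintegral_const_mul' _ _ (by simp)]
    _ ≤ _ := by gcongr

variable {e : Euc n} {f f' : Euc n → F}

/-- The derivative falls on the kernel, and `y ↦ φ (x - y)` is an admissible test function; its
reflection accounts for the sign. -/
theorem HasWeakDirDeriv.fderiv_normed_convolution (h : HasWeakDirDeriv e f f')
    (φ : ContDiffBump (0 : Euc n)) (x : Euc n) :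
    fderiv ℝ (φ.normed volume ⋆[ContinuousLinearMap.lsmul ℝ ℝ, volume] f) x e =
      (φ.normed volume ⋆[ContinuousLinearMap.lsmul ℝ ℝ, volume] f') x := by
  have hs : ContDiff ℝ ∞ (φ.normed (volume : Measure (Euc n))) := φ.contDiff_normed
  have hloc : LocallyIntegrable f volume := h.memLp.locallyIntegrable (by norm_num)
  have hd := φ.hasCompactSupport_normed.hasFDerivAt_convolution_left (μ := volume)
    (ContinuousLinearMap.lsmul ℝ ℝ) (hs.of_le (by norm_cast)) hloc x
  rw [hd.fderiv]
  have hex : ConvolutionExistsAt (fderiv ℝ (φ.normed volume)) f x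
      ((ContinuousLinearMap.lsmul ℝ ℝ : ℝ →L[ℝ] F →L[ℝ] F).precompL (Euc n)) volume :=
    (φ.hasCompactSupport_normed.fderiv ℝ).convolutionExists_left _
      (hs.continuous_fderiv (by simp)) hloc x
  rw [convolution_def, ContinuousLinearMap.integral_apply hex]
  simp only [ContinuousLinearMap.precompL_apply, ContinuousLinearMap.lsmul_apply]
  rw [convolution_eq_swap, ← integral_sub_left_eq_self _ _ x]
  simp only [sub_sub_cancel, ContinuousLinearMap.lsmul_apply]
  have hζ : ContDiff ℝ ∞ fun y => φ.normed volume (x - y) := hs.comp (contDiff_const.sub contDiff_id)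
  have hζs : HasCompactSupport fun y => φ.normed volume (x - y) :=
    φ.hasCompactSupport_normed.comp_homeomorph (Homeomorph.subLeft x)
  have hw := h.weak_deriv _ hζ hζs
  have hfd : ∀ y, fderiv ℝ (fun y => φ.normed volume (x - y)) y e =
      -fderiv ℝ (φ.normed volume) (x - y) e := by
    intro y
    have h1 : HasFDerivAt (fun y : Euc n => x - y) (-ContinuousLinearMap.id ℝ (Euc n)) y :=
      (hasFDerivAt_id y).const_sub x
    have h2 := ((hs.differentiable (by simp)) (x - y)).hasFDerivAt.comp y h1
    have h3 := h2.fderiv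
    rw [show (fun y => φ.normed volume (x - y)) = φ.normed volume ∘ fun y => x - y from rfl, h3]
    simp
  simp only [hfd, neg_smul, integral_neg, neg_inj] at hw
  exact hw

theorem exists_contDiffBump_seq (n : ℕ) {δ : ℝ} (hδ : 0 < δ) :
    ∃ φ : ℕ → ContDiffBump (0 : Euc n), Tendsto (fun k => (φ k).rOut) atTop (𝓝 0) ∧
      ∀ k, (φ k).rOut ≤ δ := by
  refine ⟨fun k => ⟨δ / (k + 1) / 2, δ / (k + 1), by positivity, half_lt_self (by positivity)⟩,
    ?_, fun k => ?_⟩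
  · simpa [div_eq_mul_inv] using (tendsto_one_div_add_atTop_nhds_zero_nat (𝕜 := ℝ)).const_mul δ
  · exact div_le_self hδ.le (by linarith [(Nat.cast_nonneg k : (0 : ℝ) ≤ k)])

/-- Mollifying `f` reduces to the smooth estimate. The comparison map `Ψ` is there for two uses: `Ψ
= 0` bounds the difference quotients of `f`, and `Ψ` a mollification of `f` makes those of the
remainder small uniformly in `t`. -/
theorem HasWeakDirDeriv.eLpNorm_translate_sub_sub_le [CompleteSpace F]
    (h : HasWeakDirDeriv e f f') {Ψ : Euc n → F} (hΨ : ContDiff ℝ 1 Ψ)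
    (hΨm : MemLp Ψ 2 volume) (hΨd : MemLp (fun x => fderiv ℝ Ψ x e) 2 volume) (t : ℝ) :
    eLpNorm (fun x => (f - Ψ) (x + t • e) - (f - Ψ) x) 2 volume ≤
      ‖t‖ₑ * eLpNorm (fun x => f' x - fderiv ℝ Ψ x e) 2 volume := by
  obtain ⟨φ, hφ, -⟩ := exists_contDiffBump_seq n one_pos
  set T : ℕ → (Euc n → F) → Euc n → F := fun k f =>
    (φ k).normed volume ⋆[ContinuousLinearMap.lsmul ℝ ℝ, volume] f with hT
  have hs : ∀ k, ContDiff ℝ 1 (T k f) := fun k =>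
    (φ k).hasCompactSupport_normed.contDiff_convolution_left _ (φ k).contDiff_normed
      (h.memLp.locallyIntegrable (by norm_num))
  have hfd : ∀ k x, fderiv ℝ (T k f) x e = T k f' x := fun k x => h.fderiv_normed_convolution _ x
  have hm' : ∀ k, AEStronglyMeasurable (T k f') volume := fun k =>
    ((φ k).hasCompactSupport_normed.continuous_convolution_left _ (φ k).continuous_normed
      (h.memLp_deriv.locallyIntegrable (by norm_num))).aestronglyMeasurable
  have hm : ∀ k, AEStronglyMeasurable (T k f) volume := fun k =>
    (hs k).continuous.aestronglyMeasurable
  have h0 := tendsto_eLpNorm_normed_convolution_sub φ hφ f h.memLp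
  have h1 := tendsto_eLpNorm_normed_convolution_sub φ hφ f' h.memLp_deriv
  have hlim : Tendsto (fun k => ((eLpNorm (fun x => T k f x - f x) 2 volume +
      eLpNorm (fun x => T k f x - f x) 2 volume) + ‖t‖ₑ *
      (eLpNorm (fun x => T k f' x - f' x) 2 volume +
        eLpNorm (fun x => f' x - fderiv ℝ Ψ x e) 2 volume))) atTop
      (𝓝 (‖t‖ₑ * eLpNorm (fun x => f' x - fderiv ℝ Ψ x e) 2 volume)) := by
    have := (h0.add h0).add (ENNReal.Tendsto.const_mul (a := ‖t‖ₑ)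
      (h1.add_const (eLpNorm (fun x => f' x - fderiv ℝ Ψ x e) 2 volume)) (Or.inr (by simp)))
    simpa using this
  refine ge_of_tendsto' hlim fun k => ?_
  have hsm := eLpNorm_translate_sub_le_of_contDiff (Φ := T k f - Ψ) ((hs k).sub hΨ) e t
  have hsmd : (fun x => fderiv ℝ (T k f - Ψ) x e) =
      (fun x => T k f' x - f' x) + fun x => f' x - fderiv ℝ Ψ x e := by
    ext x
    rw [fderiv_sub ((hs k).differentiable (by norm_num) x) (hΨ.differentiable (by norm_num) x)]
    simp [hfd]
  have ma : AEStronglyMeasurable (fun x => T k f x - f x) volume := (hm k).sub h.memLp.1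
  have mb : AEStronglyMeasurable (T k f - Ψ) volume := (hm k).sub hΨm.1
  have hdec : (fun x => (f - Ψ) (x + t • e) - (f - Ψ) x) =
      (-(fun x => T k f (x + t • e) - f (x + t • e)) + fun x => T k f x - f x) +
      fun x => (T k f - Ψ) (x + t • e) - (T k f - Ψ) x := by
    ext x; simp; abel
  rw [hdec]
  have mc := aestronglyMeasurable_comp_add_right ma (t • e)
  refine (eLpNorm_add_le (mc.neg.add ma)
    ((aestronglyMeasurable_comp_add_right mb (t • e)).sub mb) (by norm_num)).trans ?_
  gcongr
  · refine (eLpNorm_add_le mc.neg ma (by norm_num)).trans ?_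
    rw [eLpNorm_neg, eLpNorm_comp_add_right ma]
  · refine hsm.trans ?_
    gcongr
    rw [hsmd]
    exact eLpNorm_add_le ((hm' k).sub h.memLp_deriv.1) (h.memLp_deriv.1.sub hΨd.1) (by norm_num)

theorem HasWeakDirDeriv.eLpNorm_translate_sub_le [CompleteSpace F]
    (h : HasWeakDirDeriv e f f') (t : ℝ) :
    eLpNorm (fun x => f (x + t • e) - f x) 2 volume ≤ ‖t‖ₑ * eLpNorm f' 2 volume := by
  have := h.eLpNorm_translate_sub_sub_le (Ψ := 0) contDiff_const (by simp) (by simp) t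
  simpa using this

theorem tendsto_eLpNorm_diffQuot_sub_fderiv {ζ : Euc n → F} (hζ : ContDiff ℝ 1 ζ)
    (hc : HasCompactSupport ζ) (e : Euc n) {t : ℕ → ℝ} (ht : Tendsto t atTop (𝓝 0))
    (ht0 : ∀ k, t k ≠ 0) :
    Tendsto (fun k => eLpNorm (fun x => diffQuot e (t k) ζ x - fderiv ℝ ζ x e) 2 volume)
      atTop (𝓝 0) := by
  obtain ⟨L, hL⟩ := hζ.lipschitzWith_of_hasCompactSupport hc (by norm_num)
  have hcont : Continuous fun x => fderiv ℝ ζ x e :=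
    (hζ.continuous_fderiv (by norm_num)).clm_apply continuous_const
  have hsmall : ∀ᶠ k in atTop, |t k| < 1 := by
    have := ht.abs
    rw [abs_zero] at this
    exact this.eventually_lt_const one_pos
  refine tendsto_eLpNorm_zero_of_dominated (K := Metric.cthickening ‖e‖ (tsupport ζ))
    (Eventually.of_forall fun k => ?_) hc.isCompact.cthickening (2 * (L * ‖e‖)) ?_ ?_ ?_
  · have : Continuous fun x => diffQuot e (t k) ζ x :=
      ((hζ.continuous.comp (by fun_prop)).sub hζ.continuous).const_smul _
    exact (this.sub hcont).stronglyMeasurable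
  · filter_upwards [hsmall] with k hk x hx
    have h1 : x ∉ tsupport ζ := fun hx' => hx (Metric.self_subset_cthickening _ hx')
    have h2 : ζ (x + t k • e) = 0 := by
      by_contra hne
      refine hx (Metric.mem_cthickening_of_dist_le x _ _ _ (subset_tsupport ζ hne) ?_)
      rw [dist_eq_norm]
      simp only [sub_add_cancel_left, norm_neg, norm_smul, Real.norm_eq_abs]
      nlinarith [norm_nonneg e]
    have h3 : fderiv ℝ ζ x = 0 := by
      by_contra hne
      exact h1 (tsupport_fderiv_subset ℝ (subset_tsupport _ hne))
    simp [diffQuot, h2, image_eq_zero_of_notMem_tsupport h1, h3]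
  · refine Eventually.of_forall fun k x => ?_
    have h1 : ‖diffQuot e (t k) ζ x‖ ≤ L * ‖e‖ := by
      rw [diffQuot, norm_smul, norm_inv]
      have h2 := hL.dist_le_mul (x + t k • e) x
      rw [dist_eq_norm, dist_eq_norm, add_sub_cancel_left, norm_smul] at h2
      have h3 : 0 < ‖t k‖ := norm_pos_iff.2 (ht0 k)
      calc ‖t k‖⁻¹ * ‖ζ (x + t k • e) - ζ x‖ ≤ ‖t k‖⁻¹ * (L * (‖t k‖ * ‖e‖)) := by gcongr
        _ = L * ‖e‖ := by field_simp
    have h2 : ‖fderiv ℝ ζ x e‖ ≤ L * ‖e‖ :=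
      (ContinuousLinearMap.le_opNorm _ _).trans (by
        gcongr; exact norm_fderiv_le_of_lipschitz ℝ hL)
    exact (norm_sub_le _ _).trans (by linarith)
  · intro x
    have h1 : HasLineDerivAt ℝ ζ (fderiv ℝ ζ x e) x e :=
      ((hζ.differentiable (by norm_num)) x).hasFDerivAt.hasLineDerivAt e
    have h2 := (hasDerivAt_iff_tendsto_slope_zero.1 h1).comp
      (tendsto_nhdsWithin_iff.2 ⟨ht, Eventually.of_forall ht0⟩)
    have h3 := h2.sub_const (fderiv ℝ ζ x e)
    simpa [diffQuot, Function.comp_def] using h3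

/-- Split `f` into a mollification, whose difference quotients converge classically, and a remainder
whose difference quotients are small uniformly in the step. -/
theorem HasWeakDirDeriv.tendsto_eLpNorm_diffQuot_sub [CompleteSpace F]
    (h : HasWeakDirDeriv e f f') (hc : HasCompactSupport f) {t : ℕ → ℝ}
    (ht : Tendsto t atTop (𝓝 0)) (ht0 : ∀ k, t k ≠ 0) :
    Tendsto (fun k => eLpNorm (diffQuot e (t k) f - f') 2 volume) atTop (𝓝 0) := by
  obtain ⟨φ, hφ, -⟩ := exists_contDiffBump_seq n one_pos
  set T : ℕ → (Euc n → F) → Euc n → F := fun k f =>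
    (φ k).normed volume ⋆[ContinuousLinearMap.lsmul ℝ ℝ, volume] f with hT
  have h1 := tendsto_eLpNorm_normed_convolution_sub φ hφ f' h.memLp_deriv
  rw [ENNReal.tendsto_nhds_zero]
  intro ε hε
  have hε3 : 0 < ε / 3 := ENNReal.div_pos hε.ne' (by norm_num)
  obtain ⟨j, hj⟩ := (ENNReal.tendsto_nhds_zero.1 h1 (ε / 3) hε3).exists
  have hs : ContDiff ℝ 1 (T j f) :=
    (φ j).hasCompactSupport_normed.contDiff_convolution_left _ (φ j).contDiff_normed
      (h.memLp.locallyIntegrable (by norm_num))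
  have hfd : ∀ x, fderiv ℝ (T j f) x e = T j f' x := fun x => h.fderiv_normed_convolution _ x
  have hcs : HasCompactSupport (T j f) := HasCompactSupport.convolution _
    (φ j).hasCompactSupport_normed hc
  have hcont : Continuous fun x => fderiv ℝ (T j f) x e :=
    (hs.continuous_fderiv (by norm_num)).clm_apply continuous_const
  have hm : MemLp (T j f) 2 volume := hs.continuous.memLp_of_hasCompactSupport hcs
  have hm' : MemLp (fun x => fderiv ℝ (T j f) x e) 2 volume :=
    hcont.memLp_of_hasCompactSupport (hcs.fderiv_apply ℝ e)
  have h2 := tendsto_eLpNorm_diffQuot_sub_fderiv hs hcs e ht ht0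
  filter_upwards [ENNReal.tendsto_nhds_zero.1 h2 (ε / 3) hε3] with k hk
  have hj' : eLpNorm (fun x => f' x - fderiv ℝ (T j f) x e) 2 volume ≤ ε / 3 := by
    rw [← eLpNorm_neg]
    simp only [hfd]
    convert hj using 3 with x
    simp
    rfl
  have hd : eLpNorm (diffQuot e (t k) (f - T j f)) 2 volume ≤ ε / 3 := by
    have h3 := h.eLpNorm_translate_sub_sub_le hs hm hm' (t k)
    have h4 : diffQuot e (t k) (f - T j f) =
      (t k)⁻¹ • fun x => (f - T j f) (x + t k • e) - (f - T j f) x := rfl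
    rw [h4, eLpNorm_const_smul]
    calc _ ≤ ‖(t k)⁻¹‖ₑ * (‖t k‖ₑ * eLpNorm (fun x => f' x - fderiv ℝ (T j f) x e) 2 volume) := by
          gcongr
      _ = eLpNorm (fun x => f' x - fderiv ℝ (T j f) x e) 2 volume := by
          rw [← mul_assoc, ← enorm_mul, inv_mul_cancel₀ (ht0 k)]; simp
      _ ≤ _ := hj'
  have hdec : diffQuot e (t k) f - f' = diffQuot e (t k) (f - T j f) +
      ((fun x => diffQuot e (t k) (T j f) x - fderiv ℝ (T j f) x e) +
        -fun x => f' x - fderiv ℝ (T j f) x e) := by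
    rw [diffQuot_sub]; ext x; simp
  have m1 := ((h.memLp.sub hm).diffQuot e (t k)).1
  have m2 := ((hm.diffQuot e (t k)).sub hm').1
  have m3 := (h.memLp_deriv.sub hm').1
  rw [hdec]
  refine (eLpNorm_add_le m1 (m2.add m3.neg) (by norm_num)).trans ?_
  refine (add_le_add hd ((eLpNorm_add_le m2 m3.neg (by norm_num)).trans
    (add_le_add hk ((eLpNorm_neg _ _ _).trans_le hj')))).trans ?_
  rw [← add_assoc, ENNReal.add_thirds]

theorem HasWeakDirDeriv.exists_seq_tendsto_ae [CompleteSpace F]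
    (h : HasWeakDirDeriv e f f') (hc : HasCompactSupport f) {t : ℕ → ℝ}
    (ht : Tendsto t atTop (𝓝 0)) (ht0 : ∀ k, t k ≠ 0) :
    ∃ ns : ℕ → ℕ, StrictMono ns ∧ ∀ᵐ x, Tendsto (fun i => diffQuot e (t (ns i)) f x) atTop
      (𝓝 (f' x)) :=
  (tendstoInMeasure_of_tendsto_eLpNorm (by norm_num) (fun k => (h.memLp.diffQuot e (t k)).1)
    h.memLp_deriv.1 (h.tendsto_eLpNorm_diffQuot_sub hc ht ht0)).exists_seq_tendsto_ae

end WeakDerivative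

/-! ### Pairings in `L²` and discrete integration by parts. -/

section InnerLemmas

variable {n : ℕ} {F : Type*} [NormedAddCommGroup F] [InnerProductSpace ℝ F]

theorem inner_toLp_eq {f g : Euc n → F} (hf : MemLp f 2 volume) (hg : MemLp g 2 volume) :
    inner ℝ (hf.toLp f) (hg.toLp g) = ∫ x, inner ℝ (f x) (g x) := by
  rw [L2.inner_def]
  refine integral_congr_ae ?_
  filter_upwards [hf.coeFn_toLp, hg.coeFn_toLp] with x h1 h2
  rw [h1, h2]

theorem _root_.MeasureTheory.MemLp.integrable_inner_of_memLp {f g : Euc n → F}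
    (hf : MemLp f 2 volume) (hg : MemLp g 2 volume) :
    Integrable (fun x => (inner ℝ (f x) (g x) : ℝ)) volume := by
  refine (L2.integrable_inner (𝕜 := ℝ) (hf.toLp f) (hg.toLp g)).congr ?_
  filter_upwards [hf.coeFn_toLp, hg.coeFn_toLp] with x h1 h2
  rw [h1, h2]

theorem integral_inner_diffQuot {f g : Euc n → F} (hf : MemLp f 2 volume) (hg : MemLp g 2 volume)
    (e : Euc n) (t : ℝ) :
    ∫ x, (inner ℝ (diffQuot e t f x) (g x) : ℝ) = -∫ x, inner ℝ (f x) (diffQuot e (-t) g x) := by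
  have i1 := (hf.comp_add_right (t • e)).integrable_inner_of_memLp hg
  have i2 := hf.integrable_inner_of_memLp hg
  have i3 := hf.integrable_inner_of_memLp (hg.comp_add_right ((-t) • e))
  have h1 : ∫ x, (inner ℝ (f x) (g (x + (-t) • e)) : ℝ) = ∫ x, inner ℝ (f (x + t • e)) (g x) := by
    rw [← integral_add_right_eq_self (fun x => (inner ℝ (f x) (g (x + (-t) • e)) : ℝ)) (t • e)]
    simp
  have h2 : ∀ x, (inner ℝ (diffQuot e t f x) (g x) : ℝ) =
      t⁻¹ * (inner ℝ (f (x + t • e)) (g x) - inner ℝ (f x) (g x)) := fun x => by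
    rw [diffQuot, real_inner_smul_left, inner_sub_left]
  have h3 : ∀ x, (inner ℝ (f x) (diffQuot e (-t) g x) : ℝ) =
      (-t)⁻¹ * (inner ℝ (f x) (g (x + (-t) • e)) - inner ℝ (f x) (g x)) := fun x => by
    rw [diffQuot, real_inner_smul_right, inner_sub_right]
  simp only [h2, h3, integral_const_mul]
  rw [integral_sub i1 i2, integral_sub i3 i2, h1, inv_neg]
  ring

end InnerLemmas

/-! ### Linearity of weak derivatives. -/

section Linear

variable {n : ℕ} {F : Type*} [NormedAddCommGroup F] [NormedSpace ℝ F] {e : Euc n}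

theorem integrable_smul_of_hasCompactSupport {f : Euc n → F} (hf : MemLp f 2 volume)
    {ζ : Euc n → ℝ} (hζ : Continuous ζ) (hc : HasCompactSupport ζ) :
    Integrable (fun x => ζ x • f x) volume :=
  (hf.locallyIntegrable (by norm_num)).integrable_smul_left_of_hasCompactSupport hζ hc

theorem HasWeakDirDeriv.sub {f f' g g' : Euc n → F} (hf : HasWeakDirDeriv e f f')
    (hg : HasWeakDirDeriv e g g') : HasWeakDirDeriv e (f - g) (f' - g') := by
  refine ⟨hf.memLp.sub hg.memLp, hf.memLp_deriv.sub hg.memLp_deriv, fun ζ hζ hc => ?_⟩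
  have c1 : Continuous fun x => fderiv ℝ ζ x e :=
    (hζ.continuous_fderiv (by simp)).clm_apply continuous_const
  have c2 : HasCompactSupport fun x => fderiv ℝ ζ x e := hc.fderiv_apply ℝ e
  simp only [Pi.sub_apply, smul_sub]
  rw [integral_sub (integrable_smul_of_hasCompactSupport hf.memLp c1 c2)
      (integrable_smul_of_hasCompactSupport hg.memLp c1 c2),
    integral_sub (integrable_smul_of_hasCompactSupport hf.memLp_deriv hζ.continuous hc)
      (integrable_smul_of_hasCompactSupport hg.memLp_deriv hζ.continuous hc),
    hf.weak_deriv ζ hζ hc, hg.weak_deriv ζ hζ hc]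
  abel

end Linear

/-! ### Existence of weak derivatives from bounded difference quotients. -/

section Existence

variable {n : ℕ} {F : Type*} [NormedAddCommGroup F] [InnerProductSpace ℝ F] [CompleteSpace F]
  {e : Euc n}

/-- The sequence of steps along which difference quotients are taken. -/
noncomputable def step (k : ℕ) : ℝ := 1 / ((k : ℝ) + 1)

theorem step_pos (k : ℕ) : 0 < step k := by unfold step; positivity

theorem step_le_one (k : ℕ) : step k ≤ 1 := by
  unfold step
  exact div_le_one_of_le₀ (by linarith [(Nat.cast_nonneg k : (0 : ℝ) ≤ k)]) (by positivity)

theorem tendsto_step : Tendsto step atTop (𝓝 0) := tendsto_one_div_add_atTop_nhds_zero_nat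

/-- A bounded sequence in a Hilbert space converges weakly along an ultrafilter. -/
theorem exists_weak_limit_of_bounded {H : Type*} [NormedAddCommGroup H] [InnerProductSpace ℝ H]
    [CompleteSpace H] (d : ℕ → H) (C : ℝ) (hdC : ∀ k, ‖d k‖ ≤ C) :
    ∃ v : H, ∀ z, Tendsto (fun k => (inner ℝ (d k) z : ℝ)) (hyperfilter ℕ) (𝓝 (inner ℝ v z)) := by
  set ξ : ℕ → WeakDual ℝ H := fun k =>
    StrongDual.toWeakDual (InnerProductSpace.toDual ℝ _ (d k)) with hξ
  have hcp := WeakDual.isCompact_closedBall (𝕜 := ℝ) (0 : StrongDual ℝ H) C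
  obtain ⟨w, -, hw⟩ := hcp.ultrafilter_le_nhds ((hyperfilter ℕ).map ξ) (by
    rw [le_principal_iff, Ultrafilter.mem_coe, Ultrafilter.mem_map]
    refine Filter.univ_mem' fun k => ?_
    simp only [Set.mem_preimage, mem_closedBall_zero_iff, hξ]
    exact ((InnerProductSpace.toDual ℝ _).norm_map (d k)).trans_le (hdC k))
  refine ⟨(InnerProductSpace.toDual ℝ _).symm (WeakDual.toStrongDual w), fun z => ?_⟩
  rw [← InnerProductSpace.toDual_apply_apply (𝕜 := ℝ), LinearIsometryEquiv.apply_symm_apply]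
  exact ((WeakDual.eval_continuous z).tendsto w).comp
    (show Tendsto ξ (hyperfilter ℕ) (𝓝 w) from hw)

/-- Bounded difference quotients have a weak limit, which is the weak derivative. -/
theorem exists_hasWeakDirDeriv_of_diffQuot_bounded {f : Euc n → F} (hf : MemLp f 2 volume)
    {C : ENNReal} (hC : C ≠ ⊤) (hbd : ∀ k, eLpNorm (diffQuot e (step k) f) 2 volume ≤ C) :
    ∃ f', HasWeakDirDeriv e f f' := by
  have hdm : ∀ k, MemLp (diffQuot e (step k) f) 2 volume := fun k => hf.diffQuot e _
  set d : ℕ → Lp F 2 (volume : Measure (Euc n)) := fun k => (hdm k).toLp _ with hd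
  have hdC : ∀ k, ‖d k‖ ≤ C.toReal := fun k => by
    rw [hd, Lp.norm_toLp]
    exact ENNReal.toReal_mono hC (hbd k)
  obtain ⟨v, hlim⟩ := exists_weak_limit_of_bounded d C.toReal hdC
  refine ⟨v, hf, Lp.memLp v, fun ζ hζ hc => ?_⟩
  have c1 : Continuous fun x => fderiv ℝ ζ x e :=
    (hζ.continuous_fderiv (by simp)).clm_apply continuous_const
  have c2 : HasCompactSupport fun x => fderiv ℝ ζ x e := hc.fderiv_apply ℝ e
  refine ext_inner_left ℝ fun c => ?_
  -- The vector identity is tested against each fixed vector `c`, so that it becomes an identity of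
  -- `L²` inner products.
  set ψ : Euc n → F := fun x => ζ x • c with hψ
  have hψs : ContDiff ℝ 1 ψ := (hζ.of_le (by norm_cast)).smul contDiff_const
  have hψc : HasCompactSupport ψ := hc.smul_right
  have hψd : ∀ x, fderiv ℝ ψ x e = fderiv ℝ ζ x e • c := fun x => by
    rw [hψ, fderiv_smul_const (hζ.differentiable (by simp) x)]
    simp
  have hψm : MemLp ψ 2 volume := hψs.continuous.memLp_of_hasCompactSupport hψc
  have hψm' : MemLp (fun x => fderiv ℝ ψ x e) 2 volume := by
    simp only [hψd]
    exact (c1.smul continuous_const).memLp_of_hasCompactSupport c2.smul_right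
  have hneg : Tendsto (fun k => -step k) atTop (𝓝 0) := by simpa using tendsto_step.neg
  -- Moving a difference quotient to the other factor reverses the step. On the smooth compactly
  -- supported `ψ` the reversed quotients converge strongly, which pairs with the weak convergence
  -- of `d k`.
  have hq := tendsto_eLpNorm_diffQuot_sub_fderiv hψs hψc e hneg
    (fun k => neg_ne_zero.2 (step_pos k).ne')
  have hqL := (Lp.tendsto_Lp_iff_tendsto_eLpNorm'' _ (fun k => hψm.diffQuot e (-step k)) _ hψm').2 hq
  have hqi := (tendsto_const_nhds (x := hf.toLp f)).inner (𝕜 := ℝ) hqL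
  have h1 : ∀ k, (inner ℝ (d k) (hψm.toLp ψ) : ℝ) =
      -inner ℝ (hf.toLp f) ((hψm.diffQuot e (-step k)).toLp _) := fun k => by
    rw [hd, inner_toLp_eq, inner_toLp_eq, integral_inner_diffQuot hf hψm]
  have h2 : inner ℝ v (hψm.toLp ψ) = -inner ℝ (hf.toLp f) (hψm'.toLp _) := by
    refine tendsto_nhds_unique (hlim (hψm.toLp ψ)) ?_
    simp only [h1]
    exact hqi.neg.mono_left Nat.hyperfilter_le_atTop
  have h3 : inner ℝ v (hψm.toLp ψ) = ∫ x, ζ x * inner ℝ c (v x) := by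
    rw [L2.inner_def]
    refine integral_congr_ae ?_
    filter_upwards [hψm.coeFn_toLp] with x hx
    rw [hx, hψ, real_inner_smul_right, real_inner_comm]
  rw [inner_toLp_eq, h3] at h2
  have h4 : ∀ x, (inner ℝ (f x) (fderiv ℝ ψ x e) : ℝ) = inner ℝ c (fderiv ℝ ζ x e • f x) :=
    fun x => by rw [hψd, real_inner_smul_right, real_inner_smul_right, real_inner_comm]
  have h5 : ∀ x, ζ x * (inner ℝ c (v x) : ℝ) = inner ℝ c (ζ x • v x) :=
    fun x => by rw [real_inner_smul_right]
  simp only [h4, h5] at h2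
  rw [integral_inner (integrable_smul_of_hasCompactSupport hf c1 c2),
    integral_inner (integrable_smul_of_hasCompactSupport (Lp.memLp v) hζ.continuous hc)] at h2
  rw [inner_neg_right, h2, neg_neg]

/-- A compactly supported map which is Lipschitz with respect to `(u, x)` inherits weak
differentiability from `u`. -/
theorem exists_hasWeakDirDeriv_of_lipschitz {G : Type*} [NormedAddCommGroup G] [NormedSpace ℝ G]
    [CompleteSpace G] {u u' : Euc n → G} (hu : HasWeakDirDeriv e u u') {f : Euc n → F}
    (hf : MemLp f 2 volume) {c : Euc n} {R : ℝ} (hsupp : ∀ x ∉ Metric.closedBall c R, f x = 0)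
    {L : ℝ} (hL0 : 0 ≤ L) (hL : ∀ x y, ‖f x - f y‖ ≤ L * (‖u x - u y‖ + ‖x - y‖)) :
    ∃ f', HasWeakDirDeriv e f f' := by
  -- The steps are at most `1`, so for `x ∉ K` both `x` and `x + t e` miss the ball of radius `R`
  -- and the quotient of `f` vanishes. This keeps the term `‖x - y‖` of the Lipschitz bound in `L²`.
  set K : Set (Euc n) := Metric.closedBall c (R + ‖e‖) with hK
  have hKm : MeasurableSet K := Metric.isClosed_closedBall.measurableSet
  set b : Euc n → ℝ := K.indicator fun _ => ‖e‖ with hb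
  have hbm : MemLp b 2 volume :=
    memLp_indicator_const 2 hKm _ (Or.inr Metric.isBounded_closedBall.measure_lt_top.ne)
  refine exists_hasWeakDirDeriv_of_diffQuot_bounded hf
    (C := ‖L‖ₑ * (eLpNorm u' 2 volume + eLpNorm b 2 volume)) ?_ fun k => ?_
  · exact ENNReal.mul_ne_top (by simp) (ENNReal.add_ne_top.2 ⟨hu.memLp_deriv.2.ne, hbm.2.ne⟩)
  set t := step k
  have ht : 0 < t := step_pos k
  have hdu := hu.memLp.diffQuot e t
  have hdu' : eLpNorm (diffQuot e t u) 2 volume ≤ eLpNorm u' 2 volume := by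
    have h4 : diffQuot e t u = t⁻¹ • fun x => u (x + t • e) - u x := rfl
    rw [h4, eLpNorm_const_smul]
    calc _ ≤ ‖t⁻¹‖ₑ * (‖t‖ₑ * eLpNorm u' 2 volume) := by
          gcongr; exact hu.eLpNorm_translate_sub_le t
      _ = _ := by
          rw [← mul_assoc, ← enorm_mul, inv_mul_cancel₀ ht.ne']; simp
  have hpt : ∀ x, ‖diffQuot e t f x‖ ≤ ‖(L • ((fun x => ‖diffQuot e t u x‖) + b)) x‖ := by
    intro x
    have hb0 : 0 ≤ b x := Set.indicator_nonneg (fun _ _ => norm_nonneg e) x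
    have hrhs : ‖(L • ((fun x => ‖diffQuot e t u x‖) + b)) x‖ = L * (‖diffQuot e t u x‖ + b x) := by
      simp only [Pi.smul_apply, Pi.add_apply, smul_eq_mul]
      rw [Real.norm_of_nonneg (by positivity)]
    rw [hrhs]
    by_cases hx : x ∈ K
    · rw [hb, Set.indicator_of_mem hx, diffQuot, diffQuot, norm_smul, norm_smul, norm_inv,
        Real.norm_of_nonneg ht.le]
      have := hL (x + t • e) x
      rw [add_sub_cancel_left, norm_smul, Real.norm_of_nonneg ht.le] at this
      calc t⁻¹ * ‖f (x + t • e) - f x‖ ≤ t⁻¹ * (L * (‖u (x + t • e) - u x‖ + t * ‖e‖)) := by gcongr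
        _ = _ := by field_simp
    · have hx' : R + ‖e‖ < dist x c := by simpa [hK] using hx
      have h1 : f x = 0 := hsupp x (by
        simp only [Metric.mem_closedBall, not_le]; linarith [norm_nonneg e])
      have h2 : f (x + t • e) = 0 := hsupp _ (by
        simp only [Metric.mem_closedBall, not_le]
        have h3 : dist x c ≤ dist x (x + t • e) + dist (x + t • e) c := dist_triangle _ _ _
        have h4 : dist x (x + t • e) ≤ ‖e‖ := by
          rw [dist_comm, dist_eq_norm, add_sub_cancel_left, norm_smul, Real.norm_of_nonneg ht.le]
          exact mul_le_of_le_one_left (norm_nonneg e) (step_le_one k)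
        linarith)
      rw [diffQuot, h1, h2]
      simp only [sub_self, smul_zero, norm_zero]
      positivity
  refine (eLpNorm_mono hpt).trans ?_
  rw [eLpNorm_const_smul]
  gcongr
  refine (eLpNorm_add_le hdu.1.norm hbm.1 (by norm_num)).trans ?_
  rw [eLpNorm_norm]
  gcongr

/-- If `p ≤ f`, then the weak derivative of `f` agrees with the derivative of `p` where `p`
touches `f`. -/
theorem HasWeakDirDeriv.ae_eq_of_touching_below {f f' p : Euc n → ℝ} (h : HasWeakDirDeriv e f f')
    (hc : HasCompactSupport f) (hle : ∀ x, p x ≤ f x) :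
    ∀ᵐ x, ∀ d, f x = p x → HasLineDerivAt ℝ p d x e → f' x = d := by
  have hneg : Tendsto (fun k => -step k) atTop (𝓝 0) := by simpa using tendsto_step.neg
  obtain ⟨ns, hns, h1⟩ := h.exists_seq_tendsto_ae hc tendsto_step fun k => (step_pos k).ne'
  obtain ⟨ms, hms, h2⟩ := h.exists_seq_tendsto_ae hc hneg fun k => neg_ne_zero.2 (step_pos k).ne'
  have hslope : ∀ x d, HasLineDerivAt ℝ p d x e → ∀ t : ℕ → ℝ, Tendsto t atTop (𝓝 0) →
      (∀ k, t k ≠ 0) → Tendsto (fun k => diffQuot e (t k) p x) atTop (𝓝 d) := by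
    intro x d hd t ht ht0
    have h2 := (hasDerivAt_iff_tendsto_slope_zero.1 hd).comp
      (tendsto_nhdsWithin_iff.2 ⟨ht, Eventually.of_forall ht0⟩)
    simpa [diffQuot, Function.comp_def] using h2
  filter_upwards [h1, h2] with x hx1 hx2 d hfp hd
  -- At a touching point forward quotients of `f` dominate those of `p`, and backward quotients are
  -- dominated by them; both kinds converge to `f' x` along subsequences.
  refine le_antisymm ?_ ?_
  · have h3 := hslope x d hd (fun k => -step (ms k)) (hneg.comp hms.tendsto_atTop)
      fun k => neg_ne_zero.2 (step_pos _).ne'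
    refine le_of_tendsto_of_tendsto' hx2 h3 fun k => ?_
    simp only [diffQuot, smul_eq_mul]
    refine mul_le_mul_of_nonpos_left ?_ (inv_nonpos.2 (neg_nonpos.2 (step_pos _).le))
    linarith [hle (x + (-step (ms k)) • e)]
  · have h3 := hslope x d hd (fun k => step (ns k)) (tendsto_step.comp hns.tendsto_atTop)
      fun k => (step_pos _).ne'
    refine le_of_tendsto_of_tendsto' h3 hx1 fun k => ?_
    simp only [diffQuot, smul_eq_mul]
    refine mul_le_mul_of_nonneg_left ?_ (inv_nonneg.2 (step_pos _).le)
    linarith [hle (x + step (ns k) • e)]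

end Existence

/-! ### Retraction towards a convex set. -/

section ConvexGeometry

variable {H : Type*} [NormedAddCommGroup H] [InnerProductSpace ℝ H]

theorem exists_convex_projection [ProperSpace H] {C : Set H} (hconv : Convex ℝ C)
    (hcl : IsClosed C) (hne : C.Nonempty) :
    ∃ P : H → H, ∀ y, P y ∈ C ∧ ‖y - P y‖ = Metric.infDist y C ∧
      ∀ z ∈ C, inner ℝ (y - P y) (z - P y) ≤ (0 : ℝ) := by
  have : ∀ y, ∃ p, p ∈ C ∧ ‖y - p‖ = Metric.infDist y C ∧
      ∀ z ∈ C, inner ℝ (y - p) (z - p) ≤ (0 : ℝ) := by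
    intro y
    obtain ⟨p, hp, hd⟩ := hcl.exists_infDist_eq_dist hne y
    refine ⟨p, hp, by rw [hd, dist_eq_norm], (norm_eq_iInf_iff_real_inner_le_zero hconv hp).1 ?_⟩
    rw [← dist_eq_norm, ← hd, Metric.infDist_eq_iInf]
    simp only [dist_eq_norm]
  choose P hP using this
  exact ⟨P, hP⟩

/-- Moving two points towards their projections by the distances `τ₁` and `τ₂`. -/
theorem norm_sub_sq_retraction_le {y₁ y₂ p₁ p₂ : H} {τ₁ τ₂ : ℝ}
    (h₁ : inner ℝ (y₁ - p₁) (p₂ - p₁) ≤ (0 : ℝ)) (h₂ : inner ℝ (y₂ - p₂) (p₁ - p₂) ≤ (0 : ℝ))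
    (hτ₁ : 0 ≤ τ₁) (hτ₁' : τ₁ ≤ ‖y₁ - p₁‖) (hτ₂ : 0 ≤ τ₂) (hτ₂' : τ₂ ≤ ‖y₂ - p₂‖) :
    ‖(y₁ - (τ₁ / ‖y₁ - p₁‖) • (y₁ - p₁)) - (y₂ - (τ₂ / ‖y₂ - p₂‖) • (y₂ - p₂))‖ ^ 2 ≤
      ‖y₁ - y₂‖ ^ 2 - 2 * (‖y₁ - p₁‖ - ‖y₂ - p₂‖) * (τ₁ - τ₂) + (τ₁ - τ₂) ^ 2 := by
  -- When `h = 0` the constraint forces `τ = 0`, and division by zero returns `0`, so `τ = s * h`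
  -- survives.
  have hdiv : ∀ τ h : ℝ, 0 ≤ τ → τ ≤ h → ∃ s, s = τ / h ∧ 0 ≤ s ∧ s ≤ 1 ∧ τ = s * h := by
    intro τ h h0 h1
    refine ⟨τ / h, rfl, div_nonneg h0 (h0.trans h1), div_le_one_of_le₀ h1 (h0.trans h1), ?_⟩
    rcases eq_or_ne h 0 with rfl | hne
    · simp; linarith
    · field_simp
  obtain ⟨s, hs, hs0, hs1, hsτ⟩ := hdiv _ _ hτ₁ hτ₁'
  obtain ⟨t, ht, ht0, ht1, htτ⟩ := hdiv _ _ hτ₂ hτ₂'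
  rw [← hs, ← ht, hsτ, htτ]
  obtain ⟨a, ha⟩ : ∃ a, a = y₁ - p₁ := ⟨_, rfl⟩
  obtain ⟨b, hb⟩ : ∃ b, b = y₂ - p₂ := ⟨_, rfl⟩
  obtain ⟨D, hD⟩ : ∃ D, D = p₁ - p₂ := ⟨_, rfl⟩
  rw [← ha, ← hb]
  have e1 : y₁ - s • a - (y₂ - t • b) = D + ((1 - s) • a - (1 - t) • b) := by
    rw [hD, eq_add_of_sub_eq' ha.symm, eq_add_of_sub_eq' hb.symm]; module
  have e2 : y₁ - y₂ = D + (a - b) := by rw [hD, ha, hb]; module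
  have f1 : 0 ≤ (inner ℝ D a : ℝ) := by
    rw [← neg_sub p₁ p₂, ← hD, ← ha, inner_neg_right, real_inner_comm] at h₁
    linarith
  have f2 : (inner ℝ D b : ℝ) ≤ 0 := by
    rwa [← hD, ← hb, real_inner_comm] at h₂
  have f3 := real_inner_le_norm a b
  rw [e1, e2, norm_add_sq_real, norm_add_sq_real, norm_sub_sq_real, norm_sub_sq_real, norm_smul,
    norm_smul, inner_sub_right, inner_sub_right]
  simp only [real_inner_smul_left, real_inner_smul_right, Real.norm_eq_abs, mul_pow, sq_abs]
  -- The right side minus the left side equals `2 s ⟨D, a⟩ - 2 t ⟨D, b⟩ + 2 (1 - (1 - s)(1 - t))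
  -- (‖a‖ ‖b‖ - ⟨a, b⟩)`. The first two terms are nonnegative by the obtuse angle property of
  -- projections, the third by Cauchy–Schwarz.
  have g1 : 0 ≤ s * inner ℝ D a := mul_nonneg hs0 f1
  have g2 : t * inner ℝ D b ≤ 0 := mul_nonpos_of_nonneg_of_nonpos ht0 f2
  have g3 : 0 ≤ (1 - (1 - s) * (1 - t)) * (‖a‖ * ‖b‖ - inner ℝ a b) :=
    mul_nonneg (by nlinarith) (by linarith)
  nlinarith

/-- The displacement is the retracted point minus the original one, so its Lipschitz bound follows
from `‖V‖ ≤ ‖y₁ - y₂‖ + |τ₁ - τ₂|`, a consequence of the previous inequality. -/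
theorem norm_sub_retraction_field_le {y₁ y₂ p₁ p₂ : H} {τ₁ τ₂ : ℝ}
    (h₁ : inner ℝ (y₁ - p₁) (p₂ - p₁) ≤ (0 : ℝ)) (h₂ : inner ℝ (y₂ - p₂) (p₁ - p₂) ≤ (0 : ℝ))
    (hτ₁ : 0 ≤ τ₁) (hτ₁' : τ₁ ≤ ‖y₁ - p₁‖) (hτ₂ : 0 ≤ τ₂) (hτ₂' : τ₂ ≤ ‖y₂ - p₂‖)
    (hh : |‖y₁ - p₁‖ - ‖y₂ - p₂‖| ≤ ‖y₁ - y₂‖) :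
    ‖(-(τ₁ / ‖y₁ - p₁‖)) • (y₁ - p₁) - (-(τ₂ / ‖y₂ - p₂‖)) • (y₂ - p₂)‖ ≤
      2 * ‖y₁ - y₂‖ + |τ₁ - τ₂| := by
  have h := norm_sub_sq_retraction_le h₁ h₂ hτ₁ hτ₁' hτ₂ hτ₂'
  set V := (y₁ - (τ₁ / ‖y₁ - p₁‖) • (y₁ - p₁)) - (y₂ - (τ₂ / ‖y₂ - p₂‖) • (y₂ - p₂)) with hV
  have h3 : -((‖y₁ - p₁‖ - ‖y₂ - p₂‖) * (τ₁ - τ₂)) ≤ ‖y₁ - y₂‖ * |τ₁ - τ₂| := by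
    refine (neg_le_abs _).trans ?_
    rw [abs_mul]
    gcongr
  have h4 : ‖V‖ ≤ ‖y₁ - y₂‖ + |τ₁ - τ₂| := by
    refine abs_le_of_sq_le_sq' ?_ (by positivity) |>.2
    nlinarith [sq_abs (τ₁ - τ₂)]
  have e : (-(τ₁ / ‖y₁ - p₁‖)) • (y₁ - p₁) - (-(τ₂ / ‖y₂ - p₂‖)) • (y₂ - p₂) =
      V - (y₁ - y₂) := by rw [hV]; module
  rw [e]
  exact (norm_sub_le _ _).trans (by linarith)

theorem norm_retraction_field_le {a : H} {τ : ℝ} (hτ : 0 ≤ τ) :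
    ‖(-(τ / ‖a‖)) • a‖ ≤ τ := by
  rw [norm_smul, norm_neg, Real.norm_of_nonneg (by positivity)]
  rcases eq_or_ne ‖a‖ 0 with h | h
  · rw [h]; simpa
  · rw [div_mul_cancel₀ _ h]

/-- Points on the segment from `y` to a nearest point of `C` are not interior to `C`. -/
theorem retraction_notMem_interior {C : Set H} {y p : H} {τ : ℝ} (hy : y ∉ interior C)
    (hd : ‖y - p‖ = Metric.infDist y C) (hτ : 0 ≤ τ) (hτ' : τ ≤ ‖y - p‖) :
    y + (-(τ / ‖y - p‖)) • (y - p) ∉ interior C := by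
  rcases (norm_nonneg (y - p)).eq_or_lt with h0 | h0
  · rw [← h0]; simpa
  intro hint
  set s := τ / ‖y - p‖ with hs
  have hs0 : 0 ≤ s := by positivity
  have hs1 : s ≤ 1 := div_le_one_of_le₀ hτ' h0.le
  have hcont : Tendsto (fun δ : ℝ => y + (-s + δ) • (y - p)) (𝓝[>] 0)
      (𝓝 (y + (-s) • (y - p))) := by
    have : Continuous fun δ : ℝ => y + (-s + δ) • (y - p) := by fun_prop
    have h := (this.tendsto 0).mono_left (nhdsWithin_le_nhds (s := Set.Ioi 0))
    simpa using h
  have hev := hcont.eventually (isOpen_interior.mem_nhds hint)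
  have hlt : ∀ᶠ δ : ℝ in 𝓝[>] 0, δ < 1 := nhdsWithin_le_nhds (eventually_lt_nhds one_pos)
  -- If the point were interior, adding a small `δ` to the coefficient `-s` would stay in `C`. Since
  -- `|-s + δ| < 1`, that point is closer to `y` than `p`.
  obtain ⟨δ, ⟨hδ, hδ1⟩, hδ0⟩ := ((hev.and hlt).and self_mem_nhdsWithin).exists
  have hδ0 : 0 < δ := hδ0
  have h1 := Metric.infDist_le_dist_of_mem (x := y) (interior_subset hδ)
  rw [← hd, dist_eq_norm, sub_add_cancel_left, norm_neg, norm_smul, Real.norm_eq_abs] at h1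
  have h2 : |-s + δ| < 1 := abs_lt.2 ⟨by linarith, by linarith⟩
  nlinarith

end ConvexGeometry

/-! ### The signed distance on the closure of `M`. -/

section SignedDistance

variable {m : ℕ} {M : Set (Euc m)}

theorem frontier_eq_frontier_compl (M : Set (Euc m)) : frontier M = frontier Mᶜ :=
  (frontier_compl M).symm

theorem notMem_interior_compl {y : Euc m} : y ∈ closure M ↔ y ∉ interior Mᶜ := by
  rw [interior_compl]; simp

theorem frontier_nonempty_of_nonempty (hM : M.Nonempty) (hC : (Mᶜ).Nonempty) :
    (frontier M).Nonempty := by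
  refine nonempty_frontier_iff.2 ⟨hM, fun h => ?_⟩
  rw [h] at hC
  simp at hC

/-- On `M̄` the signed distance to `∂M` is the distance to the complement of `M`. -/
theorem rho_eq_infDist_compl (hM : M.Nonempty) (hC : (Mᶜ).Nonempty) (hcl : IsClosed Mᶜ)
    {y : Euc m} (hy : y ∈ closure M) : rho M y = Metric.infDist y Mᶜ := by
  have hsub : frontier M ⊆ Mᶜ := by
    rw [frontier_eq_frontier_compl]; exact hcl.frontier_subset
  by_cases hyM : y ∈ M
  · rw [rho, if_pos hyM]
    refine le_antisymm ?_ (Metric.infDist_le_infDist_of_subset hsub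
      (frontier_nonempty_of_nonempty hM hC))
    obtain ⟨p, hp, hd⟩ := hcl.exists_infDist_eq_dist hC y
    -- A nearest point of the complement is not interior to it: this is the retraction by the full
    -- distance.
    have hpf : p ∈ frontier M := by
      rw [frontier_eq_frontier_compl, hcl.frontier_eq]
      refine ⟨hp, ?_⟩
      have hne : ‖y - p‖ ≠ 0 := fun h => by
        rw [sub_eq_zero.1 (norm_eq_zero.1 h)] at hyM
        exact hp hyM
      have := retraction_notMem_interior (C := Mᶜ) (y := y) (p := p) (τ := ‖y - p‖)
        (notMem_interior_compl.1 hy) (by rw [hd, dist_eq_norm]) (norm_nonneg _) le_rfl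
      rw [div_self hne] at this
      simpa using this
    rw [hd]
    exact Metric.infDist_le_dist_of_mem hpf
  · rw [rho, if_neg hyM]
    have hf : y ∈ frontier M := by
      rw [frontier_eq_frontier_compl, hcl.frontier_eq]
      exact ⟨hyM, notMem_interior_compl.1 hy⟩
    rw [Metric.infDist_zero_of_mem hf, Metric.infDist_zero_of_mem (show y ∈ Mᶜ from hyM), neg_zero]

theorem mem_frontier_of_rho_eq_zero (hM : M.Nonempty) (hC : (Mᶜ).Nonempty) {y : Euc m}
    (hy : rho M y = 0) : y ∈ frontier M := by
  have h0 : Metric.infDist y (frontier M) = 0 := by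
    unfold rho at hy
    split_ifs at hy
    · exact hy
    · exact neg_eq_zero.1 hy
  exact (isClosed_frontier.mem_iff_infDist_zero (frontier_nonempty_of_nonempty hM hC)).2 h0

theorem rho_eq_zero_of_mem_frontier {y : Euc m} (hy : y ∈ frontier M) : rho M y = 0 := by
  unfold rho
  split_ifs <;> simp [Metric.infDist_zero_of_mem hy]

end SignedDistance

/-! ### From directional derivatives on `ℝⁿ` to `W^{1,2}` and `W^{1,2}_0` on `Ω`. -/

section SobolevMaps

open Convolution

variable {n m : ℕ}

/-- The linear map with prescribed values on the standard basis. -/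
noncomputable def ofPartials (w' : Fin n → Euc m) : Euc n →L[ℝ] Euc m :=
  ∑ α, (EuclideanSpace.proj α : Euc n →L[ℝ] ℝ).smulRight (w' α)

theorem ofPartials_apply (w' : Fin n → Euc m) (e : Euc n) :
    ofPartials w' e = ∑ α, e α • w' α := by
  simp [ofPartials]

theorem ofPartials_single (w' : Fin n → Euc m) (α : Fin n) :
    ofPartials w' (EuclideanSpace.single α 1) = w' α := by
  rw [ofPartials_apply, Finset.sum_eq_single α] <;> simp +contextual

theorem ofPartials_of_clm (A : Euc n →L[ℝ] Euc m) :
    ofPartials (fun α => A (EuclideanSpace.single α 1)) = A := by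
  ext1 e
  rw [ofPartials_apply]
  conv_rhs => rw [← (EuclideanSpace.basisFun (Fin n) ℝ).sum_repr e, map_sum]
  simp

theorem ofPartials_sub (v w : Fin n → Euc m) :
    ofPartials v - ofPartials w = ofPartials (fun α => v α - w α) := by
  ext1 e
  simp [ofPartials_apply, smul_sub]

theorem norm_ofPartials_le (w : Fin n → Euc m) : ‖ofPartials w‖ ≤ ∑ α, ‖w α‖ := by
  refine ContinuousLinearMap.opNorm_le_bound _ (Finset.sum_nonneg fun _ _ => norm_nonneg _)
    fun e => ?_
  rw [ofPartials_apply, Finset.sum_mul]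
  refine (norm_sum_le _ _).trans (Finset.sum_le_sum fun α _ => ?_)
  rw [norm_smul, mul_comm]
  gcongr
  exact EuclideanSpace.norm_eq e ▸ Real.abs_le_sqrt (by
    rw [← sq_abs]
    simpa using Finset.single_le_sum (f := fun i => ‖e i‖ ^ 2) (fun _ _ => sq_nonneg _)
      (Finset.mem_univ α))

theorem continuous_ofPartials : Continuous (ofPartials : (Fin n → Euc m) → _) := by
  unfold ofPartials
  refine continuous_finsetSum _ fun α _ => ?_
  exact ((ContinuousLinearMap.smulRightL ℝ (Euc n) (Euc m)
    (EuclideanSpace.proj α)).continuous).comp (continuous_apply α)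

theorem aestronglyMeasurable_ofPartials {μ : Measure (Euc n)} {w' : Fin n → Euc n → Euc m}
    (h : ∀ α, AEStronglyMeasurable (w' α) μ) :
    AEStronglyMeasurable (fun x => ofPartials fun α => w' α x) μ := by
  have : AEStronglyMeasurable (fun x => fun α => w' α x) μ :=
    (aemeasurable_pi_lambda _ fun α => (h α).aemeasurable).aestronglyMeasurable
  exact continuous_ofPartials.comp_aestronglyMeasurable this

theorem eLpNorm_ofPartials_le {μ : Measure (Euc n)} {w' : Fin n → Euc n → Euc m}
    (h : ∀ α, AEStronglyMeasurable (w' α) μ) :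
    eLpNorm (fun x => ofPartials fun α => w' α x) 2 μ ≤ ∑ α, eLpNorm (w' α) 2 μ := by
  have h1 : eLpNorm (fun x => ofPartials fun α => w' α x) 2 μ ≤
      eLpNorm (∑ α, fun x => ‖w' α x‖) 2 μ := by
    refine eLpNorm_mono_real fun x => ?_
    rw [Finset.sum_apply]
    exact norm_ofPartials_le _
  refine h1.trans ((eLpNorm_sum_le (fun α _ => (h α).norm) (by norm_num)).trans_eq ?_)
  simp only [eLpNorm_norm]

theorem memLp_ofPartials {μ : Measure (Euc n)} {w' : Fin n → Euc n → Euc m}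
    (h : ∀ α, MemLp (w' α) 2 μ) : MemLp (fun x => ofPartials fun α => w' α x) 2 μ :=
  ⟨aestronglyMeasurable_ofPartials fun α => (h α).1,
    (eLpNorm_ofPartials_le fun α => (h α).1).trans_lt (ENNReal.sum_lt_top.2 fun α _ => (h α).2)⟩

theorem integrable_smul_restrict {F : Type*} [NormedAddCommGroup F] [NormedSpace ℝ F]
    {Ω : Set (Euc n)} {f : Euc n → F} (hf : MemLp f 2 (volume.restrict Ω)) {ζ : Euc n → ℝ}
    (hζ : Continuous ζ) (hc : HasCompactSupport ζ) :
    Integrable (fun x => ζ x • f x) (volume.restrict Ω) :=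
  (hf.locallyIntegrable (by norm_num)).integrable_smul_left_of_hasCompactSupport hζ hc

theorem clm_apply_eq_sum (A : Euc n →L[ℝ] ℝ) (e : Euc n) :
    A e = ∑ α, e α * A (EuclideanSpace.single α 1) := by
  conv_lhs => rw [← (EuclideanSpace.basisFun (Fin n) ℝ).sum_repr e, map_sum]
  simp

theorem isW12_of_hasWeakDirDeriv {w : Euc n → Euc m} {w' : Fin n → Euc n → Euc m}
    (h : ∀ α, HasWeakDirDeriv (EuclideanSpace.single α 1) w (w' α)) (hw : MemLp w 2 volume)
    (Ω : Set (Euc n)) : IsW12 Ω w (fun x => ofPartials fun α => w' α x) := by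
  refine ⟨hw.restrict Ω, (memLp_ofPartials fun α => (h α).memLp_deriv).restrict Ω,
    fun φ hφ hc hs e => ?_⟩
  have hφ0 : ∀ x ∉ Ω, φ x = 0 := fun x hx => image_eq_zero_of_notMem_tsupport fun hx' => hx (hs hx')
  have hφ0' : ∀ x ∉ Ω, fderiv ℝ φ x = 0 := fun x hx => by
    by_contra hne
    exact hx (hs (tsupport_fderiv_subset ℝ (subset_tsupport _ hne)))
  rw [setIntegral_eq_integral_of_forall_compl_eq_zero (fun x hx => by simp [hφ0' x hx]),
    setIntegral_eq_integral_of_forall_compl_eq_zero (fun x hx => by simp [hφ0 x hx])]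
  have c1 : ∀ α, Continuous fun x => fderiv ℝ φ x (EuclideanSpace.single α 1) := fun α =>
    (hφ.continuous_fderiv (by simp)).clm_apply continuous_const
  have e1 : ∀ x, fderiv ℝ φ x e • w x =
      ∑ α, e α • (fderiv ℝ φ x (EuclideanSpace.single α 1) • w x) := fun x => by
    rw [clm_apply_eq_sum, Finset.sum_smul]
    simp only [mul_smul]
  have e2 : ∀ x, φ x • ofPartials (fun α => w' α x) e = ∑ α, e α • (φ x • w' α x) := fun x => by
    rw [ofPartials_apply, Finset.smul_sum]
    exact Finset.sum_congr rfl fun α _ => smul_comm _ _ _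
  simp only [e1, e2]
  have i1 : ∀ α, Integrable (fun x => e α • (fderiv ℝ φ x (EuclideanSpace.single α 1) • w x))
      volume := fun α =>
    (integrable_smul_of_hasCompactSupport hw (c1 α) (hc.fderiv_apply ℝ _)).smul (e α)
  have i2 : ∀ α, Integrable (fun x => e α • (φ x • w' α x)) volume := fun α =>
    (integrable_smul_of_hasCompactSupport (h α).memLp_deriv hφ.continuous hc).smul (e α)
  rw [integral_finsetSum _ fun α _ => i1 α, integral_finsetSum _ fun α _ => i2 α,
    ← Finset.sum_neg_distrib]
  refine Finset.sum_congr rfl fun α _ => ?_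
  rw [integral_smul, integral_smul, (h α).weak_deriv φ hφ hc, smul_neg]

/-- `MemLp.add`, with the topology and the norm of the target tied to each other by unification. -/
theorem memLp_add_fun {α F : Type*} [MeasurableSpace α] [NormedAddCommGroup F] {μ : Measure α}
    {f g : α → F} (hf : MemLp f 2 μ) (hg : MemLp g 2 μ) : MemLp (fun x => f x + g x) 2 μ :=
  hf.add hg

theorem IsW12.add {Ω : Set (Euc n)} {u w : Euc n → Euc m} {Du Dw : Euc n → Euc n →L[ℝ] Euc m}
    (hu : IsW12 Ω u Du) (hw : IsW12 Ω w Dw) :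
    IsW12 Ω (fun x => u x + w x) (fun x => Du x + Dw x) := by
  refine ⟨memLp_add_fun hu.memLp hw.memLp, memLp_add_fun hu.memLp_deriv hw.memLp_deriv,
    fun φ hφ hc hs e => ?_⟩
  have c1 : Continuous fun x => fderiv ℝ φ x e :=
    (hφ.continuous_fderiv (by simp)).clm_apply continuous_const
  have c2 : HasCompactSupport fun x => fderiv ℝ φ x e := hc.fderiv_apply ℝ e
  have hD : ∀ {D : Euc n → Euc n →L[ℝ] Euc m}, MemLp D 2 (volume.restrict Ω) →
      Integrable (fun x => φ x • D x e) (volume.restrict Ω) := fun {D} h => by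
    have hDe : MemLp (fun x => D x e) 2 (volume.restrict Ω) :=
      h.continuousLinearMap_comp (ContinuousLinearMap.apply ℝ (Euc m) e)
    exact integrable_smul_restrict hDe hφ.continuous hc
  simp only [smul_add, add_apply]
  rw [integral_add (integrable_smul_restrict hu.memLp c1 c2)
      (integrable_smul_restrict hw.memLp c1 c2), integral_add (hD hu.memLp_deriv) (hD hw.memLp_deriv),
    hu.weak_deriv φ hφ hc hs e, hw.weak_deriv φ hφ hc hs e]
  abel

/-- Mollification at scales at most `R' - R` keeps the supports in the closed ball of radius `R'`,
and commutes with the weak partial derivatives. -/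
theorem isW12Zero_of_hasWeakDirDeriv {w : Euc n → Euc m} {w' : Fin n → Euc n → Euc m}
    (h : ∀ α, HasWeakDirDeriv (EuclideanSpace.single α 1) w (w' α)) (hw : MemLp w 2 volume)
    {c : Euc n} {R R' : ℝ} (hRR : R < R') (hsupp : ∀ x ∉ Metric.closedBall c R, w x = 0)
    {Ω : Set (Euc n)} (hΩ : Metric.closedBall c R' ⊆ Ω) :
    IsW12Zero Ω w (fun x => ofPartials fun α => w' α x) := by
  obtain ⟨φ, hφ, hφδ⟩ := exists_contDiffBump_seq n (sub_pos.2 hRR)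
  have hloc := hw.locallyIntegrable (by norm_num)
  have hs : ∀ k, ContDiff ℝ ∞ ((φ k).normed volume ⋆[ContinuousLinearMap.lsmul ℝ ℝ, volume] w) :=
    fun k => (φ k).hasCompactSupport_normed.contDiff_convolution_left _ (φ k).contDiff_normed hloc
  have hts : ∀ k, tsupport ((φ k).normed volume ⋆[ContinuousLinearMap.lsmul ℝ ℝ, volume] w) ⊆
      Metric.closedBall c R' := by
    intro k
    refine closure_minimal ?_ Metric.isClosed_closedBall
    refine (support_convolution_subset _).trans ?_
    rintro _ ⟨a, ha, b, hb, rfl⟩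
    rw [(φ k).support_normed_eq, mem_ball_zero_iff] at ha
    have hb' : b ∈ Metric.closedBall c R := by
      by_contra hne
      exact hb (hsupp b hne)
    rw [Metric.mem_closedBall, dist_eq_norm] at hb' ⊢
    calc ‖a + b - c‖ = ‖a + (b - c)‖ := by rw [add_sub_assoc]
      _ ≤ ‖a‖ + ‖b - c‖ := norm_add_le _ _
      _ ≤ R' := by linarith [hφδ k]
  have hmeas : ∀ k (g : Euc n → Euc m), MemLp g 2 volume → AEStronglyMeasurable
      ((φ k).normed volume ⋆[ContinuousLinearMap.lsmul ℝ ℝ, volume] g) volume := fun k g hg =>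
    ((φ k).hasCompactSupport_normed.continuous_convolution_left _ (φ k).continuous_normed
      (hg.locallyIntegrable (by norm_num))).aestronglyMeasurable
  have key : ∀ g : Euc n → Euc m, MemLp g 2 volume → Tendsto (fun k => eLpNorm (fun x => g x -
      ((φ k).normed volume ⋆[ContinuousLinearMap.lsmul ℝ ℝ, volume] g) x) 2 volume) atTop
      (𝓝 0) := by
    intro g hg
    refine (tendsto_eLpNorm_normed_convolution_sub φ hφ g hg).congr fun k => ?_
    rw [← eLpNorm_neg]
    congr 1
    ext1 x
    simp
  refine ⟨fun k => (φ k).normed volume ⋆[ContinuousLinearMap.lsmul ℝ ℝ, volume] w,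
    fun k => ⟨hs k, HasCompactSupport.of_support_subset_isCompact (isCompact_closedBall c R')
      ((subset_tsupport _).trans (hts k)), (hts k).trans hΩ⟩, ?_, ?_⟩
  · exact tendsto_of_tendsto_of_tendsto_of_le_of_le tendsto_const_nhds (key w hw)
      (fun _ => bot_le) fun k => eLpNorm_mono_measure _ Measure.restrict_le_self
  · have hsum : Tendsto (fun k => ∑ α, eLpNorm (fun x => w' α x -
        ((φ k).normed volume ⋆[ContinuousLinearMap.lsmul ℝ ℝ, volume] w' α) x) 2 volume) atTop
        (𝓝 0) := by
      have := tendsto_finsetSum Finset.univ fun α _ => key (w' α) (h α).memLp_deriv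
      simpa using this
    refine tendsto_of_tendsto_of_tendsto_of_le_of_le tendsto_const_nhds hsum
      (fun _ => bot_le) fun k => ?_
    have hD : ∀ x, ofPartials (fun α => w' α x) -
        fderiv ℝ ((φ k).normed volume ⋆[ContinuousLinearMap.lsmul ℝ ℝ, volume] w) x =
        ofPartials fun α => w' α x -
          ((φ k).normed volume ⋆[ContinuousLinearMap.lsmul ℝ ℝ, volume] w' α) x := by
      intro x
      rw [← ofPartials_of_clm (fderiv ℝ _ x), ofPartials_sub]
      simp only [(h _).fderiv_normed_convolution]
    simp only [hD]
    exact (eLpNorm_mono_measure _ Measure.restrict_le_self).trans (eLpNorm_ofPartials_le fun α =>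
      (h α).memLp_deriv.1.sub (hmeas k _ (h α).memLp_deriv))

/-- Cutting off a Sobolev map. -/
theorem IsW12.hasWeakDirDeriv_cutoff {Ω : Set (Euc n)} (hΩ : MeasurableSet Ω) {u : Euc n → Euc m}
    {Du : Euc n → Euc n →L[ℝ] Euc m} (hu : IsW12 Ω u Du) {χ : Euc n → ℝ} (hχ : ContDiff ℝ ∞ χ)
    (hχc : HasCompactSupport χ) (hχs : tsupport χ ⊆ Ω) (e : Euc n) :
    HasWeakDirDeriv e (fun x => χ x • u x) (fun x => χ x • Du x e + fderiv ℝ χ x e • u x) := by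
  have d1 : Continuous fun x => fderiv ℝ χ x e :=
    (hχ.continuous_fderiv (by simp)).clm_apply continuous_const
  have d2 : HasCompactSupport fun x => fderiv ℝ χ x e := hχc.fderiv_apply ℝ e
  have hχ0 : ∀ x ∉ Ω, χ x = 0 := fun x hx =>
    image_eq_zero_of_notMem_tsupport fun hx' => hx (hχs hx')
  have hχ0' : ∀ x ∉ Ω, fderiv ℝ χ x e = 0 := fun x hx => by
    by_contra hne
    exact hx (hχs (tsupport_fderiv_apply_subset ℝ e (subset_tsupport _ hne)))
  have hDu : MemLp (fun x => Du x e) 2 (volume.restrict Ω) :=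
    hu.memLp_deriv.continuousLinearMap_comp (ContinuousLinearMap.apply ℝ (Euc m) e)
  have hmul : ∀ {η : Euc n → ℝ} {g : Euc n → Euc m}, Continuous η → HasCompactSupport η →
      (∀ x ∉ Ω, η x = 0) → MemLp g 2 (volume.restrict Ω) →
      MemLp (fun x => η x • g x) 2 volume := by
    intro η g hη hηc hη0 hg
    have e1 : (fun x => η x • g x) = Ω.indicator fun x => η x • g x := by
      ext1 x
      by_cases hx : x ∈ Ω
      · rw [Set.indicator_of_mem hx]
      · rw [Set.indicator_of_notMem hx, hη0 x hx, zero_smul]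
    rw [e1, memLp_indicator_iff_restrict hΩ]
    obtain ⟨C, hC⟩ := hηc.exists_bound_of_continuous hη
    refine hg.of_le_mul (c := C) (hη.aestronglyMeasurable.smul hg.1) (Eventually.of_forall fun x => ?_)
    rw [norm_smul]
    gcongr
    exact hC x
  refine ⟨hmul hχ.continuous hχc hχ0 hu.memLp,
    (hmul hχ.continuous hχc hχ0 hDu).add (hmul d1 d2 hχ0' hu.memLp), fun ζ hζ hc => ?_⟩
  have c1 : Continuous fun x => fderiv ℝ ζ x e :=
    (hζ.continuous_fderiv (by simp)).clm_apply continuous_const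
  -- The product `ζ χ` is supported in `Ω`, so it is admissible for `u` although `ζ` need not be.
  have hprod := hu.weak_deriv (fun x => ζ x * χ x) (hζ.mul hχ) hc.mul_right
    ((tsupport_mul_subset_right).trans hχs) e
  have hfd : ∀ x, fderiv ℝ (fun x => ζ x * χ x) x e =
      ζ x * fderiv ℝ χ x e + χ x * fderiv ℝ ζ x e := fun x => by
    rw [fderiv_fun_mul (hζ.differentiable (by simp) x) (hχ.differentiable (by simp) x)]
    simp
  simp only [hfd, add_smul] at hprod
  have i1 : Integrable (fun x => (ζ x * fderiv ℝ χ x e) • u x) (volume.restrict Ω) :=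
    integrable_smul_restrict hu.memLp (hζ.continuous.mul d1) d2.mul_left
  have i2 : Integrable (fun x => (χ x * fderiv ℝ ζ x e) • u x) (volume.restrict Ω) :=
    integrable_smul_restrict hu.memLp (hχ.continuous.mul c1) hχc.mul_right
  have i3 : Integrable (fun x => (ζ x * χ x) • Du x e) (volume.restrict Ω) :=
    integrable_smul_restrict hDu (hζ.continuous.mul hχ.continuous) hc.mul_right
  rw [integral_add i1 i2] at hprod
  have s1 : ∫ x in Ω, fderiv ℝ ζ x e • χ x • u x = ∫ x, fderiv ℝ ζ x e • χ x • u x :=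
    setIntegral_eq_integral_of_forall_compl_eq_zero fun x hx => by simp [hχ0 x hx]
  have s2 : ∫ x in Ω, ζ x • (χ x • Du x e + fderiv ℝ χ x e • u x) =
      ∫ x, ζ x • (χ x • Du x e + fderiv ℝ χ x e • u x) :=
    setIntegral_eq_integral_of_forall_compl_eq_zero fun x hx => by simp [hχ0 x hx, hχ0' x hx]
  rw [← s1, ← s2]
  simp only [smul_add, smul_smul]
  rw [integral_add i3 i1, neg_add, ← hprod]
  simp only [mul_comm (fderiv ℝ ζ _ e)]
  abel

end SobolevMaps

/-! ### Lipschitz functions of `(x, u)` and pointwise inequalities for their derivatives. -/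

section Superposition

variable {n : ℕ} {e : Euc n} {G : Type*} [NormedAddCommGroup G] {F : Type*} [NormedAddCommGroup F]

theorem hasCompactSupport_of_closedBall {f : Euc n → F} {c : Euc n} {R : ℝ}
    (hsupp : ∀ x ∉ Metric.closedBall c R, f x = 0) : HasCompactSupport f :=
  HasCompactSupport.intro (isCompact_closedBall c R) fun x hx => hsupp x hx

theorem memLp_superposition {u : Euc n → G} (hu : MemLp u 2 volume) {Φ : Euc n → G → F} {L : ℝ}
    (hL0 : 0 ≤ L) (hL : ∀ x x' y y', ‖Φ x y - Φ x' y'‖ ≤ L * (‖y - y'‖ + ‖x - x'‖))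
    {c : Euc n} {R : ℝ} (hsupp : ∀ x ∉ Metric.closedBall c R, Φ x (u x) = 0) :
    MemLp (fun x => Φ x (u x)) 2 volume := by
  have hcont : Continuous (Function.uncurry Φ) := by
    have : LipschitzWith (L * 2).toNNReal (Function.uncurry Φ) := by
      refine LipschitzWith.of_dist_le_mul fun p p' => ?_
      rw [Real.coe_toNNReal _ (by positivity), dist_eq_norm]
      refine (hL p.1 p'.1 p.2 p'.2).trans ?_
      rw [mul_assoc]
      gcongr
      rw [two_mul, ← dist_eq_norm, ← dist_eq_norm]
      exact add_le_add (le_max_right _ _) (le_max_left _ _)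
    exact this.continuous
  have hm : AEStronglyMeasurable (fun x => Φ x (u x)) volume :=
    hcont.comp_aestronglyMeasurable (aestronglyMeasurable_id.prodMk hu.1)
  set B : ℝ := ‖Φ c 0‖ + L * R with hB
  have hb : MemLp ((Metric.closedBall c R).indicator fun _ => B) 2 (volume : Measure (Euc n)) :=
    memLp_indicator_const 2 Metric.isClosed_closedBall.measurableSet _
      (Or.inr Metric.isBounded_closedBall.measure_lt_top.ne)
  refine (((hu.norm.const_mul L)).add hb).mono' hm (Eventually.of_forall fun x => ?_)
  simp only [Pi.add_apply]
  by_cases hx : x ∈ Metric.closedBall c R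
  · rw [Set.indicator_of_mem hx]
    have h1 := hL x c (u x) 0
    have h2 : ‖x - c‖ ≤ R := by rwa [← dist_eq_norm]
    have h3 := norm_le_norm_add_norm_sub' (Φ x (u x)) (Φ c 0)
    rw [sub_zero] at h1
    nlinarith
  · rw [Set.indicator_of_notMem hx, hsupp x hx, norm_zero, add_zero]
    positivity

variable [InnerProductSpace ℝ G] [CompleteSpace G] [InnerProductSpace ℝ F] [CompleteSpace F]

theorem exists_hasWeakDirDeriv_superposition {u u' : Euc n → G} (hu : HasWeakDirDeriv e u u')
    {Φ : Euc n → G → F} {L : ℝ}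
    (hL0 : 0 ≤ L) (hL : ∀ x x' y y', ‖Φ x y - Φ x' y'‖ ≤ L * (‖y - y'‖ + ‖x - x'‖))
    {c : Euc n} {R : ℝ} (hsupp : ∀ x ∉ Metric.closedBall c R, Φ x (u x) = 0) :
    ∃ f', HasWeakDirDeriv e (fun x => Φ x (u x)) f' :=
  exists_hasWeakDirDeriv_of_lipschitz hu (memLp_superposition hu.memLp hL0 hL hsupp) hsupp hL0
    fun x y => hL x y (u x) (u y)

/-- The increments inequality for retractions passes to weak derivatives. -/
theorem HasWeakDirDeriv.ae_retraction_inequality {u u' w w' : Euc n → F} {h h' t t' : Euc n → ℝ}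
    (hu : HasWeakDirDeriv e u u') (hw : HasWeakDirDeriv e w w') (hh : HasWeakDirDeriv e h h')
    (ht : HasWeakDirDeriv e t t') (cu : HasCompactSupport u) (cw : HasCompactSupport w)
    (ch : HasCompactSupport h) (ct : HasCompactSupport t)
    (hineq : ∀ x y, ‖(u x + w x) - (u y + w y)‖ ^ 2 ≤
      ‖u x - u y‖ ^ 2 - 2 * (h x - h y) * (t x - t y) + (t x - t y) ^ 2)
    (hwt : ∀ x, ‖w x‖ ≤ t x) :
    ∀ᵐ x, ‖u' x + w' x‖ ^ 2 ≤ ‖u' x‖ ^ 2 - 2 * h' x * t' x + t' x ^ 2 ∧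
      (t x = 0 → ‖w' x‖ ≤ t' x) := by
  -- Successive subsequences give one sequence of steps along which all four difference quotients
  -- converge a.e.
  obtain ⟨n₁, m₁, h₁⟩ := hu.exists_seq_tendsto_ae cu tendsto_step fun k => (step_pos k).ne'
  obtain ⟨n₂, m₂, h₂⟩ := hw.exists_seq_tendsto_ae cw (tendsto_step.comp m₁.tendsto_atTop)
    fun k => (step_pos _).ne'
  obtain ⟨n₃, m₃, h₃⟩ := hh.exists_seq_tendsto_ae ch
    ((tendsto_step.comp m₁.tendsto_atTop).comp m₂.tendsto_atTop) fun k => (step_pos _).ne'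
  obtain ⟨n₄, m₄, h₄⟩ := ht.exists_seq_tendsto_ae ct
    (((tendsto_step.comp m₁.tendsto_atTop).comp m₂.tendsto_atTop).comp m₃.tendsto_atTop)
    fun k => (step_pos _).ne'
  filter_upwards [h₁, h₂, h₃, h₄] with x x₁ x₂ x₃ x₄
  set s : ℕ → ℝ := fun k => step (n₁ (n₂ (n₃ (n₄ k)))) with hs
  have hs0 : ∀ k, 0 < s k := fun k => step_pos _
  have y₁ : Tendsto (fun k => diffQuot e (s k) u x) atTop (𝓝 (u' x)) :=
    ((x₁.comp m₂.tendsto_atTop).comp m₃.tendsto_atTop).comp m₄.tendsto_atTop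
  have y₂ : Tendsto (fun k => diffQuot e (s k) w x) atTop (𝓝 (w' x)) :=
    (x₂.comp m₃.tendsto_atTop).comp m₄.tendsto_atTop
  have y₃ : Tendsto (fun k => diffQuot e (s k) h x) atTop (𝓝 (h' x)) := x₃.comp m₄.tendsto_atTop
  have y₄ : Tendsto (fun k => diffQuot e (s k) t x) atTop (𝓝 (t' x)) := x₄
  constructor
  · refine le_of_tendsto_of_tendsto' ((y₁.add y₂).norm.pow 2)
      ((((y₁.norm.pow 2).sub ((y₃.const_mul 2).mul y₄))).add (y₄.pow 2)) fun k => ?_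
    have hi := hineq (x + s k • e) x
    have e1 : diffQuot e (s k) u x + diffQuot e (s k) w x = (s k)⁻¹ •
        ((u (x + s k • e) + w (x + s k • e)) - (u x + w x)) := by
      simp only [diffQuot, ← smul_add]; congr 1; abel
    rw [e1]
    simp only [diffQuot, norm_smul, mul_pow, smul_eq_mul, norm_inv, Real.norm_eq_abs, inv_pow,
      sq_abs]
    have hp : 0 < (s k ^ 2)⁻¹ := by have := hs0 k; positivity
    have := mul_le_mul_of_nonneg_left hi hp.le
    refine this.trans (le_of_eq ?_)
    rw [← inv_pow]
    ring
  -- Where `t` vanishes so does `w`, and `‖w‖ ≤ t` at the shifted point becomes an inequality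
  -- between forward quotients.
  · intro htx
    have hwx : w x = 0 := by
      have := hwt x
      rw [htx] at this
      exact norm_le_zero_iff.1 this
    refine le_of_tendsto_of_tendsto' y₂.norm y₄ fun k => ?_
    simp only [diffQuot, hwx, htx, sub_zero, norm_smul, smul_eq_mul, norm_inv]
    rw [Real.norm_of_nonneg (hs0 k).le]
    have := hs0 k
    gcongr
    exact hwt _

/-- Integration by parts against a smooth, not necessarily compactly supported, function. -/
theorem HasWeakDirDeriv.integral_mul_add_eq_zero {t t' X : Euc n → ℝ}
    (ht : HasWeakDirDeriv e t t') (hX : ContDiff ℝ ∞ X) {c : Euc n} {R : ℝ} (hR : 0 < R)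
    (hsupp : ∀ x ∉ Metric.closedBall c R, t x = 0) (ht' : ∀ᵐ x, t x = 0 → t' x = 0) :
    Integrable (fun x => X x * t' x + fderiv ℝ X x e * t x) volume ∧
      ∫ x, (X x * t' x + fderiv ℝ X x e * t x) = 0 := by
  -- `X` is cut off by a function equal to `1` near the support of `t`. Away from it the hypothesis
  -- `ht'` removes `t'` as well, so the cutoff leaves no trace.
  let χ : ContDiffBump c := ⟨R + 1, R + 2, by linarith, by linarith⟩
  have hχ : ContDiff ℝ ∞ (χ : Euc n → ℝ) := χ.contDiff
  have hχc : HasCompactSupport (χ : Euc n → ℝ) := χ.hasCompactSupport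
  set ζ : Euc n → ℝ := fun x => χ x * X x with hζ
  have hζs : ContDiff ℝ ∞ ζ := hχ.mul hX
  have hζc : HasCompactSupport ζ := hχc.mul_right
  have c1 : Continuous fun x => fderiv ℝ ζ x e :=
    (hζs.continuous_fderiv (by simp)).clm_apply continuous_const
  have i1 : Integrable (fun x => fderiv ℝ ζ x e • t x) volume :=
    integrable_smul_of_hasCompactSupport ht.memLp c1 (hζc.fderiv_apply ℝ e)
  have i2 : Integrable (fun x => ζ x • t' x) volume :=
    integrable_smul_of_hasCompactSupport ht.memLp_deriv hζs.continuous hζc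
  have hae : (fun x => ζ x • t' x + fderiv ℝ ζ x e • t x) =ᵐ[volume]
      fun x => X x * t' x + fderiv ℝ X x e * t x := by
    filter_upwards [ht'] with x hx
    by_cases hxb : x ∈ Metric.closedBall c R
    · have hev : ζ =ᶠ[𝓝 x] X := by
        have : Metric.ball c (R + 1) ∈ 𝓝 x := Metric.isOpen_ball.mem_nhds (by
          rw [Metric.mem_ball]; rw [Metric.mem_closedBall] at hxb; linarith)
        filter_upwards [this] with y hy
        rw [hζ]
        simp only
        rw [χ.one_of_mem_closedBall (Metric.ball_subset_closedBall hy), one_mul]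
      rw [hev.fderiv_eq, hev.eq_of_nhds]
      simp
    · rw [hsupp x hxb, hx (hsupp x hxb)]
      simp
  refine ⟨(i2.add i1).congr hae, ?_⟩
  rw [← integral_congr_ae hae, integral_add i2 i1, ht.weak_deriv ζ hζs hζc, add_neg_cancel]

end Superposition

/-! ### The Gaussian barrier. -/

section Barrier

variable {n : ℕ}

theorem hasFDerivAt_gaussian (b : ℝ) (x₀ x : Euc n) :
    HasFDerivAt (fun x : Euc n => Real.exp (-b * ‖x - x₀‖ ^ 2))
      ((-(2 * b) * Real.exp (-b * ‖x - x₀‖ ^ 2)) • innerSL ℝ (x - x₀)) x := by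
  have h1 : HasFDerivAt (fun x : Euc n => ‖x - x₀‖ ^ 2) (2 • innerSL ℝ (x - x₀)) x := by
    have := ((hasStrictFDerivAt_norm_sq (x - x₀)).hasFDerivAt).comp x
      ((hasFDerivAt_id x).sub_const x₀)
    simpa [Function.comp_def] using this
  have h2 := (h1.const_mul (-b)).exp
  refine h2.congr_fderiv (ContinuousLinearMap.ext fun y => ?_)
  simp
  ring

/-- A smooth function, positive precisely outside `B_r(x₀)`, superharmonic there, at least `r`
outside `B_{3r/2}(x₀)`, with scale invariant bounds. -/
theorem exists_barrier (hn : 1 ≤ n) : ∃ K : ℝ, 0 < K ∧ ∀ (x₀ : Euc n) (r : ℝ), 0 < r →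
    ∃ β : Euc n → ℝ, ContDiff ℝ ∞ β ∧ (∀ x, dist x x₀ ≤ r → β x ≤ 0) ∧
      (∀ x, r < dist x x₀ → 0 < β x) ∧ (∀ x, 3 / 2 * r ≤ dist x x₀ → r ≤ β x) ∧
      (∀ x y, |β x - β y| ≤ K * ‖x - y‖) ∧
      (∀ x, ∑ α : Fin n, fderiv ℝ β x (EuclideanSpace.single α 1) ^ 2 ≤ K ^ 2) ∧
      (∀ x, r ≤ dist x x₀ → ∑ α : Fin n, fderiv ℝ (fun y => fderiv ℝ β y
        (EuclideanSpace.single α 1)) x (EuclideanSpace.single α 1) ≤ 0) ∧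
      (∀ x, ∑ α : Fin n, fderiv ℝ (fun y => fderiv ℝ β y
        (EuclideanSpace.single α 1)) x (EuclideanSpace.single α 1) ≤ K / r) := by
  have hn' : (1 : ℝ) ≤ n := by exact_mod_cast hn
  have hgap : 0 < Real.exp (-(n : ℝ)) - Real.exp (-(n : ℝ) * (9 / 4)) :=
    sub_pos.2 (Real.exp_lt_exp.2 (by linarith))
  -- The barrier is `r c (e^{-n} - e^{-n |x - x₀|² / r²})`. It changes sign on the sphere of radius
  -- `r`, and `c` makes it equal to `r` on the sphere of radius `3r/2`.
  set c : ℝ := (Real.exp (-(n : ℝ)) - Real.exp (-(n : ℝ) * (9 / 4)))⁻¹ with hc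
  have hc0 : 0 < c := inv_pos.2 hgap
  refine ⟨2 * n ^ 2 * c, by positivity, fun x₀ r hr => ?_⟩
  set b : ℝ := n / r ^ 2 with hb
  have hb0 : 0 < b := by positivity
  set E : Euc n → ℝ := fun x => Real.exp (-b * ‖x - x₀‖ ^ 2) with hE
  have hE0 : ∀ x, 0 < E x := fun x => Real.exp_pos _
  have hEd : ∀ x, HasFDerivAt E ((-(2 * b) * E x) • innerSL ℝ (x - x₀)) x := fun x =>
    hasFDerivAt_gaussian b x₀ x
  have hEs : ContDiff ℝ ∞ E :=
    Real.contDiff_exp.comp (contDiff_const.mul ((contDiff_id.sub contDiff_const).norm_sq ℝ))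
  have hEr : ∀ ρ x, ρ * r ≤ dist x x₀ → 0 ≤ ρ → E x ≤ Real.exp (-(n : ℝ) * ρ ^ 2) := by
    intro ρ x hx hρ
    refine Real.exp_le_exp.2 ?_
    have h1 : (ρ * r) ^ 2 ≤ ‖x - x₀‖ ^ 2 := by
      rw [← dist_eq_norm]; gcongr
    have h2 : (n : ℝ) * ρ ^ 2 = b * (ρ * r) ^ 2 := by rw [hb]; field_simp
    nlinarith
  set β : Euc n → ℝ := fun x => r * c * (Real.exp (-(n : ℝ)) - E x) with hβ
  have hβd : ∀ x, HasFDerivAt β ((2 * n * c / r * E x) • innerSL ℝ (x - x₀)) x := by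
    intro x
    have := ((hEd x).const_sub (Real.exp (-(n : ℝ)))).const_mul (r * c)
    refine this.congr_fderiv (ContinuousLinearMap.ext fun y => ?_)
    simp [hb]
    field_simp
  have hβd' : ∀ x e, fderiv ℝ β x e = 2 * n * c / r * E x * inner ℝ (x - x₀) e := by
    intro x e
    rw [(hβd x).fderiv]
    simp [inner_sub_left]
  -- With `s = ‖x - x₀‖ / r` this is `s ≤ 1 + n s² ≤ exp (n s²)`.
  have hEbound : ∀ x, ‖x - x₀‖ * E x ≤ r := by
    intro x
    have h1 : ‖x - x₀‖ / r ≤ Real.exp (b * ‖x - x₀‖ ^ 2) := by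
      have h2 : b * ‖x - x₀‖ ^ 2 = n * (‖x - x₀‖ / r) ^ 2 := by rw [hb]; field_simp
      rw [h2]
      refine le_trans ?_ (Real.add_one_le_exp _)
      nlinarith [sq_nonneg (‖x - x₀‖ / r - 1), sq_nonneg (‖x - x₀‖ / r)]
    have h3 : Real.exp (b * ‖x - x₀‖ ^ 2) * E x = 1 := by
      rw [hE, ← Real.exp_add]; simp
    have h4 := mul_le_mul_of_nonneg_right h1 (hE0 x).le
    rw [h3, div_mul_eq_mul_div, div_le_one hr] at h4
    exact h4
  have hK : 2 * n * c ≤ 2 * (n : ℝ) ^ 2 * c := by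
    have : (n : ℝ) ≤ n ^ 2 := by nlinarith
    nlinarith
  have hgrad : ∀ x, ‖fderiv ℝ β x‖ ≤ 2 * n ^ 2 * c := by
    intro x
    rw [(hβd x).fderiv, norm_smul, innerSL_apply_norm, Real.norm_of_nonneg (by
      have := hE0 x; positivity)]
    calc 2 * n * c / r * E x * ‖x - x₀‖ = 2 * n * c / r * (‖x - x₀‖ * E x) := by ring
      _ ≤ 2 * n * c / r * r := by gcongr; exact hEbound x
      _ = 2 * n * c := by field_simp
      _ ≤ _ := hK
  have hcoord : ∀ (v : Euc n) (α : Fin n), inner ℝ v (EuclideanSpace.single α (1 : ℝ)) = v α := by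
    intro v α
    simp [EuclideanSpace.inner_single_right]
  -- The exponent `b = n / r²` makes the last factor dimension free; it is negative as soon as `‖x -
  -- x₀‖ ≥ r`.
  have hlap : ∀ x, ∑ α : Fin n, fderiv ℝ (fun y => fderiv ℝ β y (EuclideanSpace.single α 1)) x
      (EuclideanSpace.single α 1) =
      2 * n ^ 2 * c / r * E x * (1 - 2 * (‖x - x₀‖ ^ 2 / r ^ 2)) := by
    intro x
    have hα : ∀ α : Fin n, fderiv ℝ (fun y => fderiv ℝ β y (EuclideanSpace.single α 1)) x
        (EuclideanSpace.single α 1) = 2 * n * c / r * E x * (1 - 2 * b * ((x - x₀) α) ^ 2) := by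
      intro α
      have h1 : (fun y => fderiv ℝ β y (EuclideanSpace.single α 1)) =
          fun y => 2 * n * c / r * E y * inner ℝ (y - x₀) (EuclideanSpace.single α 1) := by
        ext1 y; exact hβd' y _
      have h2 : HasFDerivAt (fun y : Euc n => (inner ℝ (y - x₀) (EuclideanSpace.single α 1) : ℝ))
          (innerSL ℝ (EuclideanSpace.single α 1)) x := by
        refine (((innerSL ℝ (EuclideanSpace.single α (1 : ℝ) : Euc n)).hasFDerivAt (x := x)).sub_const
          (innerSL ℝ (EuclideanSpace.single α (1 : ℝ) : Euc n) x₀)).congr_of_eventuallyEq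
          (Eventually.of_forall fun y => ?_)
        simp only [innerSL_apply_apply, ← inner_sub_right]
        exact real_inner_comm _ _
      have h3 := (((hEd x).const_mul (2 * n * c / r)).mul h2).fderiv
      rw [h1]
      erw [h3]
      simp [hcoord]
      ring
    simp only [hα, ← Finset.mul_sum, Finset.sum_sub_distrib]
    rw [EuclideanSpace.norm_sq_eq]
    simp only [Real.norm_eq_abs, sq_abs, Finset.sum_const, Finset.card_univ, Fintype.card_fin,
      nsmul_eq_mul, mul_one, hb]
    field_simp
  refine ⟨β, contDiff_const.mul (contDiff_const.sub hEs), fun x hx => ?_, fun x hx => ?_,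
    fun x hx => ?_, fun x y => ?_, fun x => ?_, fun x hx => ?_, fun x => ?_⟩
  · refine mul_nonpos_of_nonneg_of_nonpos (by positivity) (sub_nonpos.2 (Real.exp_le_exp.2 ?_))
    have h1 : ‖x - x₀‖ ^ 2 ≤ r ^ 2 := by rw [← dist_eq_norm]; gcongr
    have h2 : b * r ^ 2 = n := by rw [hb]; field_simp
    nlinarith
  · refine mul_pos (by positivity) (sub_pos.2 (Real.exp_lt_exp.2 ?_))
    have h1 : r ^ 2 < ‖x - x₀‖ ^ 2 := by rw [← dist_eq_norm]; gcongr
    have h2 : b * r ^ 2 = n := by rw [hb]; field_simp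
    nlinarith
  · have h1 := hEr (3 / 2) x hx (by norm_num)
    have h2 : (3 / 2 : ℝ) ^ 2 = 9 / 4 := by norm_num
    rw [h2] at h1
    have h3 : c * (Real.exp (-(n : ℝ)) - Real.exp (-(n : ℝ) * (9 / 4))) = 1 :=
      inv_mul_cancel₀ hgap.ne'
    calc r = r * (c * (Real.exp (-(n : ℝ)) - Real.exp (-(n : ℝ) * (9 / 4)))) := by rw [h3, mul_one]
      _ ≤ r * (c * (Real.exp (-(n : ℝ)) - E x)) := by gcongr
      _ = β x := by rw [hβ]; ring
  · rw [← Real.norm_eq_abs]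
    exact Convex.norm_image_sub_le_of_norm_fderiv_le (𝕜 := ℝ) (s := Set.univ)
      (fun z _ => (hβd z).differentiableAt) (fun z _ => hgrad z) convex_univ trivial trivial
  · have h1 : ∑ α : Fin n, fderiv ℝ β x (EuclideanSpace.single α 1) ^ 2 =
        (2 * n * c / r * (‖x - x₀‖ * E x)) ^ 2 := by
      simp only [hβd', hcoord, mul_pow, ← Finset.mul_sum]
      rw [EuclideanSpace.norm_sq_eq]
      simp only [Real.norm_eq_abs, sq_abs]
      ring
    rw [h1]
    have h2 := hE0 x
    have h3 : 2 * n * c / r * (‖x - x₀‖ * E x) ≤ 2 * n ^ 2 * c :=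
      calc 2 * n * c / r * (‖x - x₀‖ * E x) ≤ 2 * n * c / r * r := by gcongr; exact hEbound x
        _ = 2 * n * c := by field_simp
        _ ≤ _ := hK
    gcongr
  · rw [hlap]
    have h1 := hE0 x
    refine mul_nonpos_of_nonneg_of_nonpos (by positivity) ?_
    have h2 : 1 ≤ ‖x - x₀‖ ^ 2 / r ^ 2 := by
      rw [one_le_div (by positivity), ← dist_eq_norm]; gcongr
    linarith
  · rw [hlap]
    have h1 := hE0 x
    have h2 : E x ≤ 1 := Real.exp_le_one_iff.2 (by nlinarith [sq_nonneg ‖x - x₀‖])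
    have h3 : 0 ≤ ‖x - x₀‖ ^ 2 / r ^ 2 := by positivity
    have h4 : E x * (1 - 2 * (‖x - x₀‖ ^ 2 / r ^ 2)) ≤ 1 := by nlinarith
    have h5 : 0 ≤ 2 * n ^ 2 * c / r := by positivity
    nlinarith

end Barrier

/-! ### The displacement field of the competitor. -/

section Retraction

variable {n m : ℕ}

/-- `P` is the nearest point projection onto the convex set `C`. -/
def IsNearestPointMap (C : Set (Euc m)) (P : Euc m → Euc m) : Prop :=
  ∀ y, P y ∈ C ∧ ‖y - P y‖ = Metric.infDist y C ∧ ∀ z ∈ C, inner ℝ (y - P y) (z - P y) ≤ (0 : ℝ)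

/-- The distance by which the competitor moves a point `y` towards `C`. -/
noncomputable def depth (C : Set (Euc m)) (δ : ℝ) (φ : Euc n → ℝ) (x : Euc n) (y : Euc m) : ℝ :=
  max (min (Metric.infDist y C) δ - φ x) 0

/-- The displacement of `y` towards `C` by the distance `depth C δ φ x y`. -/
noncomputable def displacement (C : Set (Euc m)) (P : Euc m → Euc m) (δ : ℝ) (φ : Euc n → ℝ)
    (x : Euc n) (y : Euc m) : Euc m :=
  (-(depth C δ φ x y / ‖y - P y‖)) • (y - P y)

variable {C : Set (Euc m)} {P : Euc m → Euc m} {δ : ℝ} {φ : Euc n → ℝ}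

theorem depth_nonneg (x : Euc n) (y : Euc m) : 0 ≤ depth C δ φ x y := le_max_right _ _

theorem depth_le_infDist (hφ : ∀ x, 0 ≤ φ x) (x : Euc n) (y : Euc m) :
    depth C δ φ x y ≤ Metric.infDist y C :=
  max_le (by linarith [min_le_left (Metric.infDist y C) δ, hφ x]) Metric.infDist_nonneg

theorem depth_le (hδ : 0 ≤ δ) (hφ : ∀ x, 0 ≤ φ x) (x : Euc n) (y : Euc m) :
    depth C δ φ x y ≤ δ :=
  max_le (by linarith [min_le_right (Metric.infDist y C) δ, hφ x]) hδ

/-- The cap at `δ` gives this for every `y`, with no bound on its distance to `C`; it localizes the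
competitor. -/
theorem depth_eq_zero {x : Euc n} (h : δ ≤ φ x) (y : Euc m) : depth C δ φ x y = 0 :=
  max_eq_right (by linarith [min_le_right (Metric.infDist y C) δ])

theorem depth_of_pos {x : Euc n} {y : Euc m} (h : 0 < depth C δ φ x y) :
    depth C δ φ x y = min (Metric.infDist y C) δ - φ x := by
  unfold depth at h ⊢
  rcases lt_max_iff.1 h with h | h
  · exact max_eq_left h.le
  · exact absurd h (lt_irrefl _)

theorem displacement_of_depth_eq_zero {x : Euc n} {y : Euc m} (h : depth C δ φ x y = 0) :
    displacement C P δ φ x y = 0 := by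
  simp [displacement, h]

theorem abs_infDist_sub_le (C : Set (Euc m)) (y y' : Euc m) :
    |Metric.infDist y C - Metric.infDist y' C| ≤ ‖y - y'‖ := by
  have := (Metric.lipschitz_infDist_pt C).dist_le_mul y y'
  rwa [NNReal.coe_one, one_mul, Real.dist_eq, dist_eq_norm] at this

theorem abs_min_infDist_sub_le (C : Set (Euc m)) (δ : ℝ) (y y' : Euc m) :
    |min (Metric.infDist y C) δ - min (Metric.infDist y' C) δ| ≤ ‖y - y'‖ := by
  refine (abs_min_sub_min_le_max _ _ _ _).trans (max_le (abs_infDist_sub_le C y y') ?_)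
  simp

theorem abs_depth_sub_le {K : ℝ} (hφ : ∀ x x', |φ x - φ x'| ≤ K * ‖x - x'‖) (x x' : Euc n)
    (y y' : Euc m) :
    |depth C δ φ x y - depth C δ φ x' y'| ≤ ‖y - y'‖ + K * ‖x - x'‖ := by
  refine (abs_max_sub_max_le_abs _ _ _).trans ?_
  have e : min (Metric.infDist y C) δ - φ x - (min (Metric.infDist y' C) δ - φ x') =
      (min (Metric.infDist y C) δ - min (Metric.infDist y' C) δ) - (φ x - φ x') := by ring
  rw [e]
  exact (abs_sub _ _).trans (add_le_add (abs_min_infDist_sub_le C δ y y') (hφ x x'))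

theorem norm_displacement_le (x : Euc n) (y : Euc m) :
    ‖displacement C P δ φ x y‖ ≤ depth C δ φ x y :=
  norm_retraction_field_le (depth_nonneg x y)

theorem norm_displacement_sub_le (hP : IsNearestPointMap C P) (hφ0 : ∀ x, 0 ≤ φ x) {K : ℝ}
    (hφ : ∀ x x', |φ x - φ x'| ≤ K * ‖x - x'‖) (x x' : Euc n) (y y' : Euc m) :
    ‖displacement C P δ φ x y - displacement C P δ φ x' y'‖ ≤ 3 * ‖y - y'‖ + K * ‖x - x'‖ := by
  have h1 := norm_sub_retraction_field_le ((hP y).2.2 _ (hP y').1) ((hP y').2.2 _ (hP y).1)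
    (depth_nonneg (C := C) (δ := δ) (φ := φ) x y)
    ((depth_le_infDist hφ0 x y).trans_eq (hP y).2.1.symm)
    (depth_nonneg (C := C) (δ := δ) (φ := φ) x' y')
    ((depth_le_infDist hφ0 x' y').trans_eq (hP y').2.1.symm)
    (by rw [(hP y).2.1, (hP y').2.1]; exact abs_infDist_sub_le C y y')
  have h2 := abs_depth_sub_le (C := C) (δ := δ) hφ x x' y y'
  exact h1.trans (by linarith)

theorem norm_add_displacement_sub_sq_le (hP : IsNearestPointMap C P) (hφ0 : ∀ x, 0 ≤ φ x)
    (x x' : Euc n) (y y' : Euc m) :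
    ‖(y + displacement C P δ φ x y) - (y' + displacement C P δ φ x' y')‖ ^ 2 ≤
      ‖y - y'‖ ^ 2 - 2 * (Metric.infDist y C - Metric.infDist y' C) *
        (depth C δ φ x y - depth C δ φ x' y') + (depth C δ φ x y - depth C δ φ x' y') ^ 2 := by
  have h1 := norm_sub_sq_retraction_le ((hP y).2.2 _ (hP y').1) ((hP y').2.2 _ (hP y).1)
    (depth_nonneg (C := C) (δ := δ) (φ := φ) x y)
    ((depth_le_infDist hφ0 x y).trans_eq (hP y).2.1.symm)
    (depth_nonneg (C := C) (δ := δ) (φ := φ) x' y')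
    ((depth_le_infDist hφ0 x' y').trans_eq (hP y').2.1.symm)
  simp only [displacement, neg_smul, ← sub_eq_add_neg]
  rwa [(hP y).2.1, (hP y').2.1] at h1 ⊢

/-- Weak derivatives of the displacement field along a Sobolev map, and the resulting estimate of
the derivative of the competitor. -/
theorem exists_displacement_derivatives (hP : IsNearestPointMap C P)
    (hφ0 : ∀ x, 0 ≤ φ x) {K : ℝ} (hK : 0 ≤ K) (hφ : ∀ x x', |φ x - φ x'| ≤ K * ‖x - x'‖)
    {x₀ : Euc n} {R : ℝ} (hφδ : ∀ x ∉ Metric.closedBall x₀ R, δ ≤ φ x)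
    {e : Euc n} {u u' : Euc n → Euc m} (hu : HasWeakDirDeriv e u u')
    (husupp : ∀ x ∉ Metric.closedBall x₀ R, u x = 0) :
    ∃ (w' : Euc n → Euc m) (t' : Euc n → ℝ),
      HasWeakDirDeriv e (fun x => displacement C P δ φ x (u x)) w' ∧
      HasWeakDirDeriv e (fun x => depth C δ φ x (u x)) t' ∧
      ∀ᵐ x, (depth C δ φ x (u x) = 0 → t' x = 0 ∧ w' x = 0) ∧
        (Metric.infDist (u x) C ≤ δ → 0 < depth C δ φ x (u x) →
          ∀ d, HasLineDerivAt ℝ φ d x e →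
            ‖u' x + w' x‖ ^ 2 ≤ ‖u' x‖ ^ 2 - t' x ^ 2 - 2 * d * t' x) := by
  have htsupp : ∀ x ∉ Metric.closedBall x₀ R, depth C δ φ x (u x) = 0 := fun x hx =>
    depth_eq_zero (hφδ x hx) _
  have hwsupp : ∀ x ∉ Metric.closedBall x₀ R, displacement C P δ φ x (u x) = 0 := fun x hx =>
    displacement_of_depth_eq_zero (htsupp x hx)
  -- Subtracting the values at `0` gives `H ∘ u` and `k ∘ u` compact support, since `u` vanishes
  -- outside the ball; derivatives are unaffected.
  set H : Euc m → ℝ := fun y => Metric.infDist y C - Metric.infDist 0 C with hH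
  set k : Euc m → ℝ := fun y => min (Metric.infDist y C) δ - min (Metric.infDist 0 C) δ with hk
  have hHsupp : ∀ x ∉ Metric.closedBall x₀ R, H (u x) = 0 := fun x hx => by
    rw [hH, husupp x hx]; simp
  have hksupp : ∀ x ∉ Metric.closedBall x₀ R, k (u x) = 0 := fun x hx => by
    rw [hk, husupp x hx]; simp
  obtain ⟨w', hw'⟩ := exists_hasWeakDirDeriv_superposition hu (Φ := displacement C P δ φ)
    (L := 3 + K) (by positivity) (fun x x' y y' =>
      (norm_displacement_sub_le hP hφ0 hφ x x' y y').trans (by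
        nlinarith [norm_nonneg (y - y'), norm_nonneg (x - x'), mul_nonneg hK (norm_nonneg (y - y'))]))
    hwsupp
  obtain ⟨t', ht'⟩ := exists_hasWeakDirDeriv_superposition hu (Φ := depth C δ φ)
    (L := 1 + K) (by positivity) (fun x x' y y' =>
      (abs_depth_sub_le hφ x x' y y').trans (by
        nlinarith [norm_nonneg (y - y'), norm_nonneg (x - x'), mul_nonneg hK (norm_nonneg (y - y'))]))
    htsupp
  obtain ⟨h', hh'⟩ := exists_hasWeakDirDeriv_superposition hu (Φ := fun _ => H)
    (L := 1) zero_le_one (fun x x' y y' => by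
      rw [hH, Real.norm_eq_abs, sub_sub_sub_cancel_right, one_mul]
      exact (abs_infDist_sub_le C y y').trans (by linarith [norm_nonneg (x - x')]))
    hHsupp
  obtain ⟨k', hk'⟩ := exists_hasWeakDirDeriv_superposition hu (Φ := fun _ => k)
    (L := 1) zero_le_one (fun x x' y y' => by
      rw [hk, Real.norm_eq_abs, sub_sub_sub_cancel_right, one_mul]
      exact (abs_min_infDist_sub_le C δ y y').trans (by linarith [norm_nonneg (x - x')]))
    hksupp
  refine ⟨w', t', hw', ht', ?_⟩
  have cu := hasCompactSupport_of_closedBall husupp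
  have cw := hasCompactSupport_of_closedBall hwsupp
  have cH := hasCompactSupport_of_closedBall hHsupp
  have ck := hasCompactSupport_of_closedBall hksupp
  have ct := hasCompactSupport_of_closedBall htsupp
  have a1 := hu.ae_retraction_inequality hw' hh' ht' cu cw cH ct
    (fun x y => by
      have := norm_add_displacement_sub_sq_le (δ := δ) hP hφ0 x y (u x) (u y)
      simpa only [hH, sub_sub_sub_cancel_right] using this)
    (fun x => norm_displacement_le x (u x))
  -- Three contacts from below. `t ≥ 0` gives `t' = 0` where `t = 0`. `h ≥ min h δ` gives `h' = k'`
  -- where `h ≤ δ`. `t ≥ min h δ - φ` gives `t' = k' - d` where `t > 0`. The truncation `k` is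
  -- needed because `t ≥ h - φ` may fail where `h > δ`.
  have a2 := ht'.ae_eq_of_touching_below ct (p := fun _ => 0) fun x => depth_nonneg x (u x)
  have a3 := (hh'.sub hk').ae_eq_of_touching_below (cH.sub ck)
    (p := fun _ => min (Metric.infDist 0 C) δ - Metric.infDist 0 C) fun x => by
      simp only [hH, hk, Pi.sub_apply]
      linarith [min_le_left (Metric.infDist (u x) C) δ]
  have a4 := (ht'.sub hk').ae_eq_of_touching_below (ct.sub ck)
    (p := fun x => -φ x + min (Metric.infDist 0 C) δ) fun x => by
      have : min (Metric.infDist (u x) C) δ - φ x ≤ depth C δ φ x (u x) := le_max_left _ _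
      simp only [hk, Pi.sub_apply]
      linarith
  filter_upwards [a1, a2, a3, a4] with x x1 x2 x3 x4
  have hconst : ∀ c : ℝ, HasLineDerivAt ℝ (fun _ : Euc n => c) 0 x e := fun c => by
    unfold HasLineDerivAt; exact hasDerivAt_const _ _
  refine ⟨fun h0 => ?_, fun hle hpos d hd => ?_⟩
  · have ht0 := x2 0 h0 (hconst 0)
    refine ⟨ht0, ?_⟩
    have := x1.2 h0
    rw [ht0] at this
    exact norm_le_zero_iff.1 this
  · have e1 : h' x - k' x = 0 := x3 0 (by
      simp only [hH, hk, Pi.sub_apply, min_eq_left hle]; ring) (hconst _)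
    have hd' : HasLineDerivAt ℝ (fun x => -φ x + min (Metric.infDist 0 C) δ) (-d) x e := by
      unfold HasLineDerivAt at hd ⊢
      exact hd.neg.add_const _
    have e2 : t' x - k' x = -d := x4 (-d) (by
      simp only [hk, Pi.sub_apply, depth_of_pos hpos]; ring) hd'
    -- Substituting this into the retraction inequality turns `-2 h' t' + t'²` into `-t'² - 2 d t'`.
    have e3 : h' x = t' x + d := by linarith
    have := x1.1
    rw [e3] at this
    linarith

end Retraction

/-! ### Comparison with the competitor. -/

section Main

variable {n m : ℕ}

theorem integrable_frobSq {Ω : Set (Euc n)} {D : Euc n → Euc n →L[ℝ] Euc m}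
    (hD : MemLp D 2 (volume.restrict Ω)) :
    Integrable (fun x => frobSq (D x)) (volume.restrict Ω) := by
  refine integrable_finsetSum _ fun α _ => ?_
  have h : MemLp (fun x => D x (EuclideanSpace.single α 1)) 2 (volume.restrict Ω) :=
    hD.continuousLinearMap_comp
      (ContinuousLinearMap.apply ℝ (Euc m) (EuclideanSpace.single α (1 : ℝ)))
  exact h.norm.integrable_sq

theorem frobSq_nonneg (A : Euc n →L[ℝ] Euc m) : 0 ≤ frobSq A :=
  Finset.sum_nonneg fun _ _ => sq_nonneg _

theorem integrable_indicator_preimage {Ω : Set (Euc n)} (hb : Bornology.IsBounded Ω)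
    {M : Set (Euc m)} (hM : IsOpen M) {u : Euc n → Euc m}
    (hu : AEStronglyMeasurable u (volume.restrict Ω)) :
    Integrable ((u ⁻¹' M).indicator fun _ => (1 : ℝ)) (volume.restrict Ω) := by
  have : IsFiniteMeasure (volume.restrict Ω) := ⟨by simpa using hb.measure_lt_top⟩
  have h1 : (u ⁻¹' M).indicator (fun _ => (1 : ℝ)) = (M.indicator fun _ => (1 : ℝ)) ∘ u := by
    classical
    ext x
    simp only [Set.indicator_apply, Set.mem_preimage, Function.comp_apply]
  refine Integrable.of_bound (C := 1) ?_ (Eventually.of_forall fun x => ?_)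
  · rw [h1]
    exact ((measurable_const.indicator hM.measurableSet).comp_aemeasurable
      hu.aemeasurable).aestronglyMeasurable
  · classical
    rw [Set.indicator_apply]
    split_ifs <;> simp

/-- The pointwise gain in energy where the competitor differs from the map: `a` and `b` are the
derivatives of the barrier and of the depth `t`, and `l` is the Laplacian of the barrier. -/
theorem two_mul_sum_add_le {a b : Fin n → ℝ} {ε K r l t : ℝ} (hε : 0 < ε) (hr : 0 < r)
    (ha : ∑ α, a α ^ 2 ≤ K ^ 2) (hl : l ≤ K / r) (hK : 0 < K) (ht0 : 0 ≤ t) (ht : t ≤ ε * r) :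
    2 * ε * (∑ α, a α * b α + l * t) ≤ ∑ α, b α ^ 2 + (2 * K + K ^ 2) * ε ^ 2 := by
  -- Young's inequality `2 ε a b ≤ b² + ε² a²`, term by term.
  have h1 : 2 * ε * ∑ α, a α * b α ≤ ∑ α, b α ^ 2 + ε ^ 2 * ∑ α, a α ^ 2 := by
    rw [Finset.mul_sum, Finset.mul_sum, ← Finset.sum_add_distrib]
    exact Finset.sum_le_sum fun α _ => by nlinarith [sq_nonneg (b α - ε * a α)]
  have h2 : l * t ≤ K * ε := by
    calc l * t ≤ K / r * t := by gcongr
      _ ≤ K / r * (ε * r) := by gcongr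
      _ = K * ε := by field_simp
  nlinarith [mul_le_mul_of_nonneg_left ha (sq_nonneg ε)]

theorem frobSq_add_ofPartials (A : Euc n →L[ℝ] Euc m) (w' : Fin n → Euc m) :
    frobSq (A + ofPartials w') = ∑ α, ‖A (EuclideanSpace.single α 1) + w' α‖ ^ 2 := by
  unfold frobSq
  refine Finset.sum_congr rfl fun α _ => ?_
  rw [add_apply, ofPartials_single]

/-- The energy comparison. A pointwise bound of the competitor's density contains a multiple of `S`,
which integrates to zero, and a gain of at least `c = q² - (2K + K²) ε² > 0` on `{u ∈ M} ∩ B_r`. -/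
theorem ae_notMem_of_isMinimizing {q ε K : ℝ} (hn : 1 ≤ n) (hε : 0 < ε) (hK : 0 < K)
    (hεK : (2 * K + K ^ 2) * ε ^ 2 < q ^ 2)
    {x₀ : Euc n} {r : ℝ} (hr : 0 < r) {β : Euc n → ℝ} (hβs : ContDiff ℝ ∞ β)
    (hβneg : ∀ x, dist x x₀ ≤ r → β x ≤ 0) (hβpos : ∀ x, r < dist x x₀ → 0 < β x)
    (hβr : ∀ x, 3 / 2 * r ≤ dist x x₀ → r ≤ β x)
    (hβL : ∀ x y, |β x - β y| ≤ K * ‖x - y‖)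
    (hβg : ∀ x, ∑ α : Fin n, fderiv ℝ β x (EuclideanSpace.single α 1) ^ 2 ≤ K ^ 2)
    (hβl : ∀ x, r ≤ dist x x₀ → ∑ α : Fin n, fderiv ℝ (fun y => fderiv ℝ β y
      (EuclideanSpace.single α 1)) x (EuclideanSpace.single α 1) ≤ 0)
    (hβl' : ∀ x, ∑ α : Fin n, fderiv ℝ (fun y => fderiv ℝ β y
      (EuclideanSpace.single α 1)) x (EuclideanSpace.single α 1) ≤ K / r)
    {M : Set (Euc m)} {Ω : Set (Euc n)} {u : Euc n → Euc m} (hM : IsOpen M) (hMne : M.Nonempty)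
    (hconv : Convex ℝ Mᶜ) (hcl : IsClosed Mᶜ) (hCne : (Mᶜ).Nonempty) (hΩ : IsOpen Ω)
    (hΩb : Bornology.IsBounded Ω) (hmin : IsMinimizing q M Ω u)
    (hball : Metric.ball x₀ (2 * r) ⊆ Ω)
    (hsmall : ∀ᵐ x ∂volume.restrict (Metric.ball x₀ (2 * r)), rho M (u x) ≤ ε * r) :
    ∀ᵐ x ∂volume.restrict Ω, x ∈ Metric.ball x₀ r → u x ∉ M := by
  obtain ⟨Du, ⟨hu, hucl⟩, hmin⟩ := hmin
  obtain ⟨P, hP⟩ : ∃ P, IsNearestPointMap Mᶜ P := exists_convex_projection hconv hcl hCne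
  set δ : ℝ := ε * r with hδ
  have hδ0 : 0 < δ := by positivity
  set φ : Euc n → ℝ := fun x => max (ε * β x) 0 with hφ
  have hφ0 : ∀ x, 0 ≤ φ x := fun x => le_max_right _ _
  have hφL : ∀ x x', |φ x - φ x'| ≤ (ε * K) * ‖x - x'‖ := by
    intro x x'
    refine (abs_max_sub_max_le_abs _ _ _).trans ?_
    rw [← mul_sub, abs_mul, abs_of_pos hε, mul_assoc]
    gcongr
    exact hβL x x'
  have hφδ : ∀ x, 3 / 2 * r ≤ dist x x₀ → δ ≤ φ x := fun x hx =>
    (mul_le_mul_of_nonneg_left (hβr x hx) hε.le).trans (le_max_left _ _)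
  -- The depth lives in the ball of radius `3r/2`. The cutoff is `1` on the larger ball of radius
  -- `7r/4`, so `v` and its derivatives agree with those of `u` there, and its support stays inside
  -- `B_{2r}`.
  let χ : ContDiffBump x₀ := ⟨7 / 4 * r, 15 / 8 * r, by positivity, by linarith⟩
  have hχs : ContDiff ℝ ∞ (χ : Euc n → ℝ) := χ.contDiff
  have hχt : tsupport (χ : Euc n → ℝ) ⊆ Metric.ball x₀ (2 * r) := by
    rw [χ.tsupport_eq]
    exact Metric.closedBall_subset_ball (by change 15 / 8 * r < 2 * r; linarith)
  set v : Euc n → Euc m := fun x => χ x • u x with hv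
  have hvd := hu.hasWeakDirDeriv_cutoff hΩ.measurableSet hχs χ.hasCompactSupport (hχt.trans hball)
  have hvsupp : ∀ x ∉ Metric.closedBall x₀ (2 * r), v x = 0 := fun x hx => by
    have : χ x = 0 := image_eq_zero_of_notMem_tsupport fun h =>
      hx (Metric.ball_subset_closedBall (hχt h))
    rw [hv]; simp [this]
  have hvu : ∀ x, dist x x₀ < 7 / 4 * r → v x = u x := fun x hx => by
    rw [hv]
    simp only
    rw [χ.one_of_mem_closedBall (show dist x x₀ ≤ _ from hx.le), one_smul]
  have hvu' : ∀ x, dist x x₀ < 7 / 4 * r → ∀ e : Euc n,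
      χ x • Du x e + fderiv ℝ χ x e • u x = Du x e := fun x hx e => by
    have hev : (χ : Euc n → ℝ) =ᶠ[𝓝 x] fun _ => 1 := by
      filter_upwards [Metric.isOpen_ball.mem_nhds (show x ∈ Metric.ball x₀ (7 / 4 * r) from hx)]
        with y hy using χ.one_of_mem_closedBall (Metric.ball_subset_closedBall hy)
    rw [hev.fderiv_eq, hev.eq_of_nhds]
    simp
  choose w' t' hw ht hae using fun α : Fin n => exists_displacement_derivatives (δ := δ) hP hφ0
    (by positivity) hφL (x₀ := x₀) (R := 2 * r) (fun x hx => hφδ x (by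
      have : 2 * r < dist x x₀ := by simpa using hx
      linarith)) (hvd (EuclideanSpace.single α 1)) hvsupp
  set t : Euc n → ℝ := fun x => depth Mᶜ δ φ x (v x) with ht_def
  set w : Euc n → Euc m := fun x => displacement Mᶜ P δ φ x (v x) with hw_def
  have htsupp : ∀ x, t x ≠ 0 → dist x x₀ < 3 / 2 * r := fun x hx => by
    by_contra hne
    exact hx (depth_eq_zero (hφδ x (not_lt.1 hne)) _)
  have ht0 : ∀ x, 0 ≤ t x := fun x => depth_nonneg x (v x)
  have htsupp' : ∀ x ∉ Metric.closedBall x₀ (3 / 2 * r), t x = 0 := fun x hx => by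
    by_contra hne
    exact hx (htsupp x hne).le
  have hwsupp : ∀ x ∉ Metric.closedBall x₀ (3 / 2 * r), w x = 0 := fun x hx =>
    displacement_of_depth_eq_zero (htsupp' x hx)
  have hwm : MemLp w 2 volume := (hw ⟨0, hn⟩).memLp
  have hdist : ∀ᵐ x ∂volume.restrict Ω, x ∈ Metric.ball x₀ (2 * r) →
      Metric.infDist (u x) Mᶜ ≤ δ := by
    have h1 : ∀ᵐ x ∂volume.restrict Ω, x ∈ Metric.ball x₀ (2 * r) → rho M (u x) ≤ δ :=
      ae_restrict_of_ae ((ae_restrict_iff' Metric.isOpen_ball.measurableSet).1 hsmall)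
    filter_upwards [h1, hucl] with x hx hxc hxb
    rw [← rho_eq_infDist_compl hMne hCne hcl hxc]
    exact hx hxb
  -- `φ` may have a kink on this sphere; off it, `φ` coincides locally with `0` or with `ε β`.
  have hsphere : ∀ᵐ x : Euc n, dist x x₀ ≠ r := by
    have := Measure.addHaar_sphere_of_ne_zero (volume : Measure (Euc n)) x₀ hr.ne'
    rw [ae_iff]
    simpa [Metric.sphere] using this
  have hae' : ∀ᵐ x ∂volume.restrict Ω, ∀ α, (t x = 0 → t' α x = 0 ∧ w' α x = 0) ∧
      (Metric.infDist (v x) Mᶜ ≤ δ → 0 < t x →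
        ∀ d, HasLineDerivAt ℝ φ d x (EuclideanSpace.single α 1) →
          ‖χ x • Du x (EuclideanSpace.single α 1) +
              fderiv ℝ χ x (EuclideanSpace.single α 1) • u x + w' α x‖ ^ 2 ≤
            ‖χ x • Du x (EuclideanSpace.single α 1) +
              fderiv ℝ χ x (EuclideanSpace.single α 1) • u x‖ ^ 2 - t' α x ^ 2 -
              2 * d * t' α x) :=
    ae_restrict_of_ae (ae_all_iff.2 hae)
  set V : Euc n → Euc m := fun x => u x + w x with hV
  set DV : Euc n → Euc n →L[ℝ] Euc m := fun x => Du x + ofPartials fun α => w' α x with hDV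
  have hVcl : ∀ᵐ x ∂volume.restrict Ω, V x ∈ closure M := by
    filter_upwards [hucl] with x hx
    by_cases htx : t x = 0
    · simp only [hV, hw_def, displacement_of_depth_eq_zero htx, add_zero]
      exact hx
    · have hvx := hvu x (by linarith [htsupp x htx])
      rw [notMem_interior_compl]
      simp only [hV, hw_def, displacement, hvx]
      exact retraction_notMem_interior (notMem_interior_compl.1 hx) (hP _).2.1 (depth_nonneg _ _)
        ((depth_le_infDist hφ0 _ _).trans_eq (hP _).2.1.symm)
  have hVW : IsConstraintMap M Ω V DV := ⟨hu.add (isW12_of_hasWeakDirDeriv hw hwm Ω), hVcl⟩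
  have hzero : IsW12Zero Ω (fun x => V x - u x) (fun x => DV x - Du x) := by
    simp only [hV, hDV, add_sub_cancel_left]
    exact isW12Zero_of_hasWeakDirDeriv hw hwm (R := 3 / 2 * r) (R' := 7 / 4 * r) (by linarith)
      hwsupp ((Metric.closedBall_subset_ball (by linarith)).trans hball)
  have henergy := hmin V DV hVW hzero
  set X : Fin n → Euc n → ℝ := fun α y => fderiv ℝ β y (EuclideanSpace.single α 1) with hX
  have hXs : ∀ α, ContDiff ℝ ∞ (X α) := fun α =>
    (hβs.fderiv_right (m := ∞) (by simp)).clm_apply contDiff_const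
  -- `S = Dβ·Dt + t Δβ` is the divergence of `t Dβ`. Using the smooth `β` in place of `φ` avoids the
  -- kink.
  set S : Euc n → ℝ := fun x => ∑ α, (X α x * t' α x +
    fderiv ℝ (X α) x (EuclideanSpace.single α 1) * t x) with hS
  have hparts : ∀ α, Integrable (fun x => X α x * t' α x +
      fderiv ℝ (X α) x (EuclideanSpace.single α 1) * t x) volume ∧
      ∫ x, (X α x * t' α x + fderiv ℝ (X α) x (EuclideanSpace.single α 1) * t x) = 0 := fun α =>
    (ht α).integral_mul_add_eq_zero (hXs α) (by positivity) htsupp' (by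
      filter_upwards [hae α] with x hx h0 using (hx.1 h0).1)
  have hSi : Integrable S volume := integrable_finsetSum _ fun α _ => (hparts α).1
  have hSz : ∫ x in Ω, S x = 0 := by
    have h1 : ∫ x in Ω, S x = ∫ x, S x := by
      refine setIntegral_eq_integral_of_ae_compl_eq_zero ?_
      filter_upwards [ae_all_iff.2 hae] with x hx hxΩ
      have htx : t x = 0 := htsupp' x fun h =>
        hxΩ (hball (Metric.closedBall_subset_ball (by linarith) h))
      refine Finset.sum_eq_zero fun α _ => ?_
      rw [((hx α).1 htx).1, htx]
      simp
    rw [h1, integral_finsetSum _ fun α _ => (hparts α).1]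
    exact Finset.sum_eq_zero fun α _ => (hparts α).2
  set J : (Euc n → Euc m) → Euc n → ℝ := fun v => (v ⁻¹' M).indicator fun _ => 1 with hJ
  have hJ0 : ∀ v x, 0 ≤ J v x := fun v x => Set.indicator_nonneg (fun _ _ => zero_le_one) _
  have hJ1 : ∀ v x, J v x ≤ 1 := fun v x => Set.indicator_le_self' (fun _ _ => zero_le_one) x
  set A : Euc n → ℝ := (Metric.ball x₀ r).indicator (J u) with hA
  have hJi : Integrable (J u) (volume.restrict Ω) :=
    integrable_indicator_preimage hΩb hM hu.memLp.1
  have hAi : Integrable A (volume.restrict Ω) := hJi.indicator Metric.isOpen_ball.measurableSet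
  have hfi := integrable_frobSq hu.memLp_deriv
  set c : ℝ := q ^ 2 - (2 * K + K ^ 2) * ε ^ 2 with hc
  have hpt : ∀ᵐ x ∂volume.restrict Ω, frobSq (DV x) + q ^ 2 * J V x ≤
      frobSq (Du x) + q ^ 2 * J u x - c * A x - 2 * ε * S x := by
    filter_upwards [hae', hdist, ae_restrict_of_ae hsphere] with x hx hxd hxs
    rcases (ht0 x).eq_or_lt with htx | htx
    · have hVx : V x = u x := by
        simp only [hV, hw_def, displacement_of_depth_eq_zero htx.symm, add_zero]
      have hJV : J V x = J u x := by
        classical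
        simp only [hJ, Set.indicator_apply, Set.mem_preimage, hVx]
      have hSx : S x = 0 := Finset.sum_eq_zero fun α _ => by
        rw [((hx α).1 htx.symm).1, ← htx]; simp
      have hDVx : DV x = Du x := by
        have : (fun α => w' α x) = 0 := funext fun α => ((hx α).1 htx.symm).2
        simp only [hDV, this]
        ext1 e
        simp [ofPartials_apply]
      -- In `B_r` the depth is the distance to the complement, so zero depth means that `u x` was
      -- already outside `M`.
      have hAx : A x = 0 := by
        by_cases hxb : x ∈ Metric.ball x₀ r
        · have hxb' : dist x x₀ < r := hxb
          have h1 := hxd (Metric.ball_subset_ball (by linarith) hxb)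
          have h2 : φ x = 0 := max_eq_right
            (mul_nonpos_of_nonneg_of_nonpos hε.le (hβneg x hxb'.le))
          have h3 : t x = Metric.infDist (u x) Mᶜ := by
            simp only [ht_def, depth, hvu x (by linarith), h2, sub_zero, min_eq_left h1]
            exact max_eq_left Metric.infDist_nonneg
          have h4 : u x ∈ Mᶜ := (hcl.mem_iff_infDist_zero hCne).2 (h3 ▸ htx.symm)
          rw [hA, Set.indicator_of_mem hxb]
          exact Set.indicator_of_notMem (s := u ⁻¹' M) h4 _
        · exact Set.indicator_of_notMem hxb _
      rw [hJV, hSx, hDVx, hAx]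
      simp
    · have hx32 := htsupp x htx.ne'
      have hvx : v x = u x := hvu x (by linarith)
      have hxd' := hxd (show dist x x₀ < 2 * r by linarith)
      have htle : t x ≤ ε * r := depth_le hδ0.le hφ0 x (v x)
      have huM : u x ∈ M := by
        by_contra hne
        have h1 : t x ≤ Metric.infDist (v x) Mᶜ := depth_le_infDist hφ0 x (v x)
        rw [hvx, Metric.infDist_zero_of_mem (show u x ∈ Mᶜ from hne)] at h1
        linarith
      have hJu : J u x = 1 := Set.indicator_of_mem (show x ∈ u ⁻¹' M from huM) _
      have hSx : S x = ∑ α, X α x * t' α x +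
          (∑ α, fderiv ℝ (X α) x (EuclideanSpace.single α 1)) * t x := by
        rw [hS, Finset.sum_mul, ← Finset.sum_add_distrib]
      have hfrob : ∀ d : Fin n → ℝ,
          (∀ α, HasLineDerivAt ℝ φ (d α) x (EuclideanSpace.single α 1)) →
          frobSq (DV x) ≤ frobSq (Du x) - ∑ α, t' α x ^ 2 - 2 * ∑ α, d α * t' α x := by
        intro d hd
        rw [hDV]
        simp only
        rw [frobSq_add_ofPartials, frobSq, Finset.mul_sum, ← Finset.sum_sub_distrib,
          ← Finset.sum_sub_distrib]
        refine Finset.sum_le_sum fun α _ => ?_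
        have := (hx α).2 (by rwa [hvx]) htx (d α) (hd α)
        rw [hvu' x (by linarith)] at this
        linarith
      rcases lt_or_gt_of_ne hxs with hlt | hgt
      -- Inside `B_r` the point moves all the way to `P (u x)`. The saved `q²` and the term `-|Dt|²`
      -- together pay for `2 ε S`.
      · have hφev : φ =ᶠ[𝓝 x] fun _ => 0 := by
          filter_upwards [Metric.isOpen_ball.mem_nhds (show x ∈ Metric.ball x₀ r from hlt)] with y hy
          exact max_eq_right (mul_nonpos_of_nonneg_of_nonpos hε.le
            (hβneg y (Metric.mem_ball.1 hy).le))
        have h1 := hfrob (fun _ => 0) fun α => by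
          exact ((hasFDerivAt_const (0 : ℝ) x).congr_of_eventuallyEq hφev).hasLineDerivAt
            (EuclideanSpace.single α (1 : ℝ))
        have hAx : A x = 1 := by
          rw [hA, Set.indicator_of_mem (show x ∈ Metric.ball x₀ r from hlt), hJu]
        have hJV : J V x = 0 := by
          refine Set.indicator_of_notMem (s := V ⁻¹' M) ?_ _
          have h2 : t x = Metric.infDist (u x) Mᶜ := by
            have h3 := depth_of_pos htx
            change t x = _ at h3
            rw [h3, hvx, min_eq_left hxd', hφev.eq_of_nhds, sub_zero]
          have h3 : w x = -(u x - P (u x)) := by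
            have h4 : t x / ‖u x - P (u x)‖ = 1 := by
              rw [h2, (hP (u x)).2.1, div_self]
              rw [← h2]; exact htx.ne'
            simp only [hw_def, displacement, hvx]
            rw [show depth Mᶜ δ φ x (u x) = t x by rw [ht_def]; simp only [hvx], h4]
            simp
          simp only [Set.mem_preimage, hV, h3]
          rw [neg_sub, add_sub_cancel]
          exact (hP (u x)).1
        have h2 := two_mul_sum_add_le (a := fun α => X α x) (b := fun α => t' α x) hε hr (hβg x)
          (hβl' x) hK htx.le htle
        rw [hJV, hJu, hAx, hSx, hc]
        simp only [zero_mul, Finset.sum_const_zero, mul_zero, sub_zero] at h1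
        linarith
      -- Outside `B_r` the term `-2 ε Dβ·Dt` is already available, and the remaining part `t Δβ` of
      -- `S` is nonpositive.
      · have hφev : φ =ᶠ[𝓝 x] fun y => ε * β y := by
          have hopen : IsOpen {y : Euc n | r < dist y x₀} :=
            isOpen_lt continuous_const (continuous_id.dist continuous_const)
          filter_upwards [hopen.mem_nhds hgt] with y hy
          exact max_eq_left (mul_pos hε (hβpos y hy)).le
        have h1 := hfrob (fun α => ε * X α x) fun α => by
          have h2 := (hβs.differentiable (by simp) x).hasFDerivAt.const_mul ε
          have := (h2.congr_of_eventuallyEq hφev).hasLineDerivAt (EuclideanSpace.single α (1 : ℝ))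
          simpa using this
        have hAx : A x = 0 := Set.indicator_of_notMem (fun h => by
          have : dist x x₀ < r := h
          linarith) _
        have h2 : (∑ α, fderiv ℝ (X α) x (EuclideanSpace.single α 1)) * t x ≤ 0 :=
          mul_nonpos_of_nonpos_of_nonneg (hβl x hgt.le) htx.le
        have h3 : ∑ α, ε * X α x * t' α x = ε * ∑ α, X α x * t' α x := by
          rw [Finset.mul_sum]; exact Finset.sum_congr rfl fun α _ => mul_assoc _ _ _
        have h4 : 0 ≤ ∑ α, t' α x ^ 2 := Finset.sum_nonneg fun _ _ => sq_nonneg _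
        have h5 : q ^ 2 * J V x ≤ q ^ 2 := mul_le_of_le_one_right (sq_nonneg q) (hJ1 V x)
        rw [hJu, hAx, hSx]
        rw [h3] at h1
        nlinarith
  have hRi : Integrable (fun x => frobSq (Du x) + q ^ 2 * J u x) (volume.restrict Ω) :=
    hfi.add (hJi.const_mul _)
  have hRi' : Integrable (fun x => frobSq (Du x) + q ^ 2 * J u x - c * A x) (volume.restrict Ω) :=
    hRi.sub (hAi.const_mul c)
  have hSi' : Integrable (fun x => 2 * ε * S x) (volume.restrict Ω) :=
    (hSi.restrict (s := Ω)).const_mul _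
  have hcmp : energy q M Ω V DV ≤
      ∫ x in Ω, (frobSq (Du x) + q ^ 2 * J u x - c * A x - 2 * ε * S x) :=
    integral_mono_of_nonneg (Eventually.of_forall fun x =>
      add_nonneg (frobSq_nonneg _) (mul_nonneg (sq_nonneg q) (hJ0 V x))) (hRi'.sub hSi') hpt
  rw [integral_sub hRi' hSi', integral_sub hRi (hAi.const_mul c), integral_const_mul,
    integral_const_mul, hSz] at hcmp
  have henergy' : ∫ x in Ω, (frobSq (Du x) + q ^ 2 * J u x) ≤ energy q M Ω V DV := henergy
  have hA0 : 0 ≤ᵐ[volume.restrict Ω] A := Eventually.of_forall fun x =>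
    Set.indicator_nonneg (fun _ _ => hJ0 _ _) x
  -- Minimality and the integrated comparison leave `c ∫ A ≤ 0`, with `c > 0` and `A ≥ 0`.
  have hAz : ∫ x in Ω, A x = 0 := by
    have h1 : 0 ≤ ∫ x in Ω, A x := integral_nonneg_of_ae hA0
    have h2 : 0 < c := by rw [hc]; linarith
    nlinarith
  filter_upwards [(integral_eq_zero_iff_of_nonneg_ae hA0 hAi).1 hAz] with x hx hxb huM
  rw [hA, Set.indicator_of_mem hxb] at hx
  rw [show J u x = 1 from Set.indicator_of_mem (show x ∈ u ⁻¹' M from huM) _] at hx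
  simp at hx

end Main

end ConstraintMap

/-! ### The choice of `ε` and the passage to the boundary. -/

theorem proposition8p1 (n m : ℕ) (hn : 1 ≤ n) (hm : 2 ≤ m) (q κ : ℝ) (hq : 0 < q) (hκ : 0 ≤ κ) :
    ∃ ε : ℝ, 0 < ε ∧
      ∀ (M : Set (ConstraintMap.Euc m)) (Ω : Set (ConstraintMap.Euc n))
        (u : ConstraintMap.Euc n → ConstraintMap.Euc m),
        ConstraintMap.IsC3Domain M →
        Convex ℝ Mᶜ → IsClosed Mᶜ → (interior Mᶜ).Nonempty →
        ConstraintMap.CurvatureBounded M κ →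
        IsOpen Ω → IsConnected Ω → Bornology.IsBounded Ω →
        ConstraintMap.IsMinimizing q M Ω u →
        ∀ (x₀ : ConstraintMap.Euc n) (r : ℝ), 0 < r → r < 1 →
          Metric.ball x₀ (2 * r) ⊆ Ω →
          (∀ᵐ x ∂volume.restrict (Metric.ball x₀ (2 * r)), ConstraintMap.rho M (u x) ≤ ε * r) →
          (∀ᵐ x ∂volume.restrict (Metric.ball x₀ r), u x ∈ frontier M) ∧
          (ContinuousOn (fun x => ConstraintMap.rho M (u x)) (Metric.ball x₀ r) →
            Metric.ball x₀ r ⊆ u ⁻¹' frontier M) := by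
  obtain ⟨K, hK, hbar⟩ := ConstraintMap.exists_barrier hn
  -- Any positive `ε` with `(2K + K²) ε² < q²` would do; here `2K + K² < (2 (K + 1))²`.
  refine ⟨q / (2 * (K + 1)), by positivity, ?_⟩
  intro M Ω u hM hconv hcl hint _ hΩ _ hΩb hmin x₀ r hr _ hball hsmall
  obtain ⟨β, b1, b2, b3, b4, b5, b6, b7, b8⟩ := hbar x₀ r hr
  have hMne : M.Nonempty := hM.isConnected.nonempty
  have hCne : (Mᶜ).Nonempty := hint.mono interior_subset
  have hεK : (2 * K + K ^ 2) * (q / (2 * (K + 1))) ^ 2 < q ^ 2 := by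
    rw [div_pow, mul_div_assoc', div_lt_iff₀ (by positivity)]
    have : 2 * K + K ^ 2 < (2 * (K + 1)) ^ 2 := by nlinarith
    have hq2 : 0 < q ^ 2 := by positivity
    nlinarith
  have hball' : Metric.ball x₀ r ⊆ Ω := (Metric.ball_subset_ball (by linarith)).trans hball
  have hout := ConstraintMap.ae_notMem_of_isMinimizing hn (by positivity) hK hεK hr b1 b2 b3 b4 b5
    b6 b7 b8 hM.isOpen hMne hconv hcl hCne hΩ hΩb hmin hball hsmall
  obtain ⟨Du, ⟨-, hucl⟩, -⟩ := hmin
  have hfr : ∀ᵐ x ∂volume.restrict (Metric.ball x₀ r), u x ∈ frontier M := by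
    filter_upwards [ae_restrict_of_ae_restrict_of_subset hball' hout,
      ae_restrict_of_ae_restrict_of_subset hball' hucl,
      ae_restrict_mem Metric.isOpen_ball.measurableSet] with x h1 h2 h3
    rw [hM.isOpen.frontier_eq]
    exact ⟨h2, h1 h3⟩
  refine ⟨hfr, fun hcont x hx => ?_⟩
  -- A continuous function vanishing a.e. on an open ball vanishes everywhere there, and `rho M`
  -- vanishes only on the frontier.
  have heq : Set.EqOn (fun x => ConstraintMap.rho M (u x)) (fun _ => 0) (Metric.ball x₀ r) := by
    refine Measure.eqOn_open_of_ae_eq (μ := volume) ?_ Metric.isOpen_ball hcont continuousOn_const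
    filter_upwards [hfr] with x hx using ConstraintMap.rho_eq_zero_of_mem_frontier hx
  exact ConstraintMap.mem_frontier_of_rho_eq_zero hMne hCne (heq hx)
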